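/- Let $n\ge 1$, $N=2n$, and let $(\cdot,\cdot)$ be the standard bilinear form on $\mathbb C^N$. For $r=(r_1,\dots,r_{2n})$ put $\bar r=(r_{n+1},\dots,r_{2n},-r_1,\dots,-r_n)$. Let $A_N=\mathbb C[t_1^{\pm1},\dots,t_N^{\pm1}]$, $d_i=t_i\,\partial/\partial t_i$, $t^r=t_1^{r_1}\cdots t_N^{r_N}$, and let $\mathfrak H_N\subset \mathrm{Der}(A_N)$ be the Hamiltonian Lie algebra, spanned by $H_r=\sum_{i=1}^N \bar r_i\,t^r d_i$ ($0\ne r\in\mathbb Z^N$) and $d_1,\dots,d_N$. For $\alpha,\beta\in\mathbb C^N$ and an $\mathfrak{sp}_N$-module $V$ let $F^{\alpha,\beta}(V)=V\otimes A_N$ be the $\mathfrak H_N$-module with $$H_r(v\otimes t^s)=\big((\bar r,s+\alpha)\,v+(r\bar r^{\,t})v\big)\otimes t^{r+s},\qquad d_i(v\otimes t^s)=(s_i+\beta_i)\,v\otimes t^s ,$$ where $r\bar r^{\,t}\in\mathfrak{sp}_N$. For $1\le k\le n$ let $V(\delta_k)$ be the irreducible $\mathfrak{sp}_N$-module whose highest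 weight is the $k$-th fundamental weight $\delta_k$, and for $2\le k\le n$ let $\theta_k:\bigwedge^k\mathbb C^N\to\bigwedge^{k-2}\mathbb C^N$ be the contraction $$\theta_k(v_1\wedge\dots\wedge v_k)=\sum_{r<s}(-1)^{r+s-1}(v_r,\bar v_s)\,v_1\wedge\dots\widehat{v_r}\dots\widehat{v_s}\dots\wedge v_k .$$ **Theorem.** For all $1\le k\le n$ and all $\alpha,\beta\in\mathbb C^N$ the $\mathfrak H_N$-module $F^{\alpha,\beta}(V(\delta_k))$ is reducible, that is, it has a submodule different from $0$ and from the whole module. More precisely: (i) If $k=1$, then $V(\delta_1)\cong\mathbb C^N$ as $\mathfrak{sp}_N$-modules and, under any such isomorphism, the span of the vectors $(r+\alpha)\otimes t^r$, $r\in\mathbb Z^N$, is a nonzero proper submodule. (ii) If $k\ge 2$, then $V(\delta_k)\cong \mathrm{Ker}\,\theta_k$ as $\mathfrak{sp}_N$-modules and, under any such isomorphism, the subspace $$\bigoplus_{\substack{r\in\mathbb Z^N\\ r+\alpha\neq0}}\Big(\big((r+\alpha)\wedge\textstyle\bigwedge^{k-1}\mathbb C^N\big)\cap \mathrm{Ker}\,\theta_k\Big)\otimes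 t^r\;\oplus\bigoplus_{\substack{r\in\mathbb Z^N\\ r+\alpha=0}}\mathrm{Ker}\,\theta_k\otimes t^{r}$$ is a nonzero proper submodule (the last sum has at most one term, and it is absent if $\alpha\notin\mathbb Z^N$). -/

import Mathlib

open scoped Matrix TensorProduct

/- Matrices and endomorphisms carry the commutator bracket. -/
attribute [local instance 100] LieRing.ofAssociativeRing

noncomputable section

namespace Hamiltonian

/-- The `N = 2n` coordinates; `Sum.inl i` is the coordinate `i` and `Sum.inr i` is `n + i`. -/
abbrev Idx (n : ℕ) : Type := Fin n ⊕ Fin n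

/-- The map `r = (r₁, …, rₙ, rₙ₊₁, …, r₂ₙ) ↦ r̄ = (rₙ₊₁, …, r₂ₙ, -r₁, …, -rₙ)`. -/
def bar {n : ℕ} {R : Type*} [Neg R] (r : Idx n → R) : Idx n → R :=
  Sum.elim (fun i => r (Sum.inr i)) (fun i => -r (Sum.inl i))

/-- The inclusion `ℤ^N ⊆ ℂ^N`. -/
def toC {n : ℕ} (r : Idx n → ℤ) : Idx n → ℂ := fun i => (r i : ℂ)

@[simp] lemma toC_add {n : ℕ} (r s : Idx n → ℤ) : toC (r + s) = toC r + toC s := by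
  ext i; simp [toC]

@[simp] lemma toC_neg {n : ℕ} (r : Idx n → ℤ) : toC (-r) = -toC r := by
  ext i; simp [toC]

@[simp] lemma toC_zero {n : ℕ} : toC (0 : Idx n → ℤ) = 0 := by
  ext i; simp [toC]

lemma toC_injective {n : ℕ} : Function.Injective (toC (n := n)) := by
  intro r s h
  ext i
  have := congrFun h i
  simpa [toC] using this

@[simp] lemma bar_add {n : ℕ} {R : Type*} [AddCommGroup R] (r s : Idx n → R) :
    bar (r + s) = bar r + bar s := by
  ext i; rcases i with i | i <;> simp [bar]; abel

@[simp] lemma bar_neg {n : ℕ} {R : Type*} [AddCommGroup R] (r : Idx n → R) :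
    bar (-r) = -bar r := by
  ext i; rcases i with i | i <;> simp [bar]

lemma bar_dotProduct {n : ℕ} {R : Type*} [CommRing R] (r s : Idx n → R) :
    bar r ⬝ᵥ s = -(bar s ⬝ᵥ r) := by
  simp only [dotProduct, bar, Fintype.sum_sum_type, Sum.elim_inl, Sum.elim_inr, neg_mul,
    Finset.sum_neg_distrib, mul_comm (s _)]
  ring

lemma bar_dotProduct_self {n : ℕ} {R : Type*} [CommRing R] (r : Idx n → R) :
    bar r ⬝ᵥ r = 0 := by
  simp only [dotProduct, bar, Fintype.sum_sum_type, Sum.elim_inl, Sum.elim_inr, neg_mul,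
    Finset.sum_neg_distrib]
  simp [mul_comm]

/-! ### The symplectic Lie algebra and its fundamental modules -/

/-- The symplectic Lie algebra `𝔰𝔭_N`, `N = 2n`, over `ℂ`. -/
abbrev Sp (n : ℕ) : LieSubalgebra ℂ (Matrix (Idx n) (Idx n) ℂ) :=
  LieAlgebra.Symplectic.sp (Fin n) ℂ

lemma fromBlocks_mem {n : ℕ} (a b c : Matrix (Fin n) (Fin n) ℂ) (hb : bᵀ = b) (hc : cᵀ = c) :
    Matrix.fromBlocks a b c (-aᵀ) ∈ Sp n := by
  change _ ∈ skewAdjointMatricesLieSubalgebra _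
  rw [mem_skewAdjointMatricesLieSubalgebra, mem_skewAdjointMatricesSubmodule]
  simp [Matrix.IsSkewAdjoint, Matrix.IsAdjointPair, Matrix.J, Matrix.fromBlocks_transpose,
    Matrix.fromBlocks_multiply, Matrix.fromBlocks_neg, hb, hc]

/-- `h_i = e_{i,i} - e_{n+i,n+i}`. -/
def hElt {n : ℕ} (i : Fin n) : Sp n :=
  ⟨Matrix.fromBlocks (Matrix.single i i 1) 0 0 (-(Matrix.single i i 1)ᵀ),
    fromBlocks_mem _ _ _ (by simp) (by simp)⟩

/-- `X_{ε_i - ε_j} = e_{i,j} - e_{n+j,n+i}`. -/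
def xMinus {n : ℕ} (i j : Fin n) : Sp n :=
  ⟨Matrix.fromBlocks (Matrix.single i j 1) 0 0 (-(Matrix.single i j 1)ᵀ),
    fromBlocks_mem _ _ _ (by simp) (by simp)⟩

/-- `X_{ε_k + ε_l} = e_{k,n+l} + e_{l,n+k}`. -/
def xPlus {n : ℕ} (k l : Fin n) : Sp n :=
  ⟨Matrix.fromBlocks 0 (Matrix.single k l 1 + Matrix.single l k 1) 0 (-0ᵀ),
    fromBlocks_mem _ _ _ (by simp [add_comm]) (by simp)⟩

/-- The simple coroots `α_j^∨ = h_j - h_{j+1}` for `j < n` and `α_n^∨ = h_n`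
(the index `j` is shifted by one, since `Fin n` starts at `0`). -/
def coroot {n : ℕ} (j : Fin n) : Sp n :=
  if h : j.val + 1 < n then hElt j - hElt ⟨j.val + 1, h⟩ else hElt j

/-- `V` is (a model of) the fundamental module `V(δ_k)`: it is irreducible and has a nonzero vector
that is killed by all positive root vectors and has weight `δ_k`, where `δ_k(α_j^∨) = δ_{k,j}`. -/
structure IsFundamental (n k : ℕ) (V : Type*) [AddCommGroup V] [Module ℂ V]
    [LieRingModule (Sp n) V] [LieModule ℂ (Sp n) V] : Prop where
  irreducible : LieModule.IsIrreducible ℂ (Sp n) V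
  exists_highest : ∃ v : V, v ≠ 0 ∧
    (∀ i j : Fin n, i < j → ⁅xMinus i j, v⁆ = 0) ∧
    (∀ i j : Fin n, ⁅xPlus i j, v⁆ = 0) ∧
    (∀ j : Fin n, ⁅coroot j, v⁆ = (if j.val + 1 = k then (1 : ℂ) else 0) • v)

/-- `r r̄ᵗ ∈ 𝔰𝔭_N` for a column vector `r`. -/
def rankOne {n : ℕ} (r : Idx n → ℂ) : Sp n :=
  ⟨Matrix.vecMulVec r (bar r), by
    have : Matrix.vecMulVec r (bar r) = Matrix.fromBlocks
        (Matrix.vecMulVec (r ∘ Sum.inl) (r ∘ Sum.inr))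
        (-Matrix.vecMulVec (r ∘ Sum.inl) (r ∘ Sum.inl))
        (Matrix.vecMulVec (r ∘ Sum.inr) (r ∘ Sum.inr))
        (-(Matrix.vecMulVec (r ∘ Sum.inl) (r ∘ Sum.inr))ᵀ) := by
      ext i j
      rcases i with i | i <;> rcases j with j | j <;>
        simp [Matrix.vecMulVec, bar, mul_comm]
    rw [this]
    apply fromBlocks_mem
    · ext i j; simp [Matrix.vecMulVec, mul_comm]
    · ext i j; simp [Matrix.vecMulVec, mul_comm]⟩

lemma rankOne_lie {n : ℕ} (r s : Idx n → ℂ) :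
    ⁅rankOne r, rankOne s⁆ =
      (bar r ⬝ᵥ s) • (rankOne (r + s) - rankOne r - rankOne s) := by
  apply Subtype.ext
  have h := bar_dotProduct s r
  change Matrix.vecMulVec r (bar r) * Matrix.vecMulVec s (bar s) -
    Matrix.vecMulVec s (bar s) * Matrix.vecMulVec r (bar r) =
    (bar r ⬝ᵥ s) • (Matrix.vecMulVec (r + s) (bar (r + s)) - Matrix.vecMulVec r (bar r) -
      Matrix.vecMulVec s (bar s))
  rw [Matrix.vecMulVec_mul_vecMulVec, Matrix.vecMulVec_mul_vecMulVec, h]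
  ext i j
  simp [Matrix.vecMulVec]
  ring

/-! ### The Witt algebra and the Hamiltonian Lie algebra -/

/-- The Laurent polynomial ring `A_N = ℂ[t₁^{±1}, …, t_N^{±1}]`; `t^s` is `single s 1`. -/
abbrev Laurent (n : ℕ) : Type := AddMonoidAlgebra ℂ (Idx n → ℤ)

/-- The monomial `t^s`. -/
abbrev mono {n : ℕ} (s : Idx n → ℤ) : Laurent n := AddMonoidAlgebra.single s 1

/-- The monomials as a basis of `A_N`. -/
def monoBasis (n : ℕ) : Module.Basis (Idx n → ℤ) ℂ (Laurent n) :=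
  .ofRepr (AddMonoidAlgebra.coeffLinearEquiv ℂ)

@[simp] lemma monoBasis_apply {n : ℕ} (s : Idx n → ℤ) : monoBasis n s = mono s := rfl

/-- The linear endomorphism `t^s ↦ c s • t^{r+s}` of `A_N`. -/
def shiftOp {n : ℕ} (r : Idx n → ℤ) (c : (Idx n → ℤ) → ℂ) : Laurent n →ₗ[ℂ] Laurent n :=
  (monoBasis n).constr ℂ fun s => c s • mono (r + s)

@[simp] lemma shiftOp_mono {n : ℕ} (r : Idx n → ℤ) (c : (Idx n → ℤ) → ℂ) (s : Idx n → ℤ) :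
    shiftOp r c (mono s) = c s • mono (r + s) := by
  rw [shiftOp, ← monoBasis_apply, Module.Basis.constr_basis]

lemma mono_mul {n : ℕ} (r s : Idx n → ℤ) : (mono r * mono s : Laurent n) = mono (r + s) := by
  simp [AddMonoidAlgebra.single_mul_single]

/-- The derivation `D(u,r) = ∑ u_i t^r d_i` of `A_N`, that is, `t^s ↦ (u,s) t^{r+s}`. -/
def wittD {n : ℕ} (u : Idx n → ℂ) (r : Idx n → ℤ) : Derivation ℂ (Laurent n) (Laurent n) :=
  Derivation.mk' (shiftOp r fun s => u ⬝ᵥ toC s) (by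
    set f := shiftOp r fun s => u ⬝ᵥ toC s with hf
    have key : (LinearMap.mul ℂ (Laurent n)).compr₂ f =
        (LinearMap.mul ℂ (Laurent n)).compl₂ f +
          ((LinearMap.mul ℂ (Laurent n)).compl₂ f).flip := by
      refine (monoBasis n).ext fun s => (monoBasis n).ext fun m => ?_
      simp only [monoBasis_apply, LinearMap.compr₂_apply, LinearMap.mul_apply', mono_mul, hf,
        shiftOp_mono, LinearMap.add_apply, LinearMap.compl₂_apply, LinearMap.flip_apply,
        mul_smul_comm, toC_add, dotProduct_add, add_smul]
      rw [show s + (r + m) = r + (s + m) by abel, show m + (r + s) = r + (s + m) by abel, add_comm]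
    intro a b
    simpa using LinearMap.congr_fun₂ key a b)

@[simp] lemma wittD_mono {n : ℕ} (u : Idx n → ℂ) (r s : Idx n → ℤ) :
    wittD u r (mono s) = (u ⬝ᵥ toC s) • mono (r + s) := by
  change shiftOp r _ (mono s) = _
  rw [shiftOp_mono]

lemma derivation_ext {n : ℕ} {D E : Derivation ℂ (Laurent n) (Laurent n)}
    (h : ∀ s, D (mono s) = E (mono s)) : D = E := by
  have : (D : Laurent n →ₗ[ℂ] Laurent n) = E := (monoBasis n).ext fun s => by simpa using h s
  ext1 a
  simpa using LinearMap.congr_fun this a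

lemma wittD_lie {n : ℕ} (u v : Idx n → ℂ) (r s : Idx n → ℤ) :
    ⁅wittD u r, wittD v s⁆ = wittD ((u ⬝ᵥ toC s) • v - (v ⬝ᵥ toC r) • u) (r + s) := by
  apply derivation_ext
  intro m
  rw [Derivation.commutator_apply]
  simp only [wittD_mono, Derivation.map_smul, smul_smul, toC_add, dotProduct_add,
    sub_dotProduct, smul_dotProduct, smul_eq_mul]
  rw [show r + (s + m) = r + s + m by abel, show s + (r + m) = r + s + m by abel, ← sub_smul]
  congr 1
  ring

/-- `H_r = D(r̄, r)`. -/
def wittH {n : ℕ} (r : Idx n → ℤ) : Derivation ℂ (Laurent n) (Laurent n) :=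
  wittD (bar (toC r)) r

/-- The degree derivation `d_i = t_i ∂/∂t_i`. -/
def wittDeg {n : ℕ} (i : Idx n) : Derivation ℂ (Laurent n) (Laurent n) :=
  wittD (Pi.single i 1) 0

lemma wittH_zero {n : ℕ} : wittH (0 : Idx n → ℤ) = 0 := by
  apply derivation_ext
  intro m
  have : bar (0 : Idx n → ℂ) = 0 := by ext i; rcases i with i | i <;> simp [bar]
  simp [wittH, this]

lemma wittH_lie {n : ℕ} (r s : Idx n → ℤ) :
    ⁅wittH r, wittH s⁆ = (bar (toC r) ⬝ᵥ toC s) • wittH (r + s) := by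
  rw [wittH, wittH, wittD_lie]
  apply derivation_ext
  intro m
  have h := bar_dotProduct (toC s) (toC r)
  simp only [wittH, wittD_mono, Derivation.smul_apply, smul_smul, h, toC_add, bar_add]
  congr 1
  simp [add_dotProduct]
  ring

lemma wittDeg_lie_wittH {n : ℕ} (i : Idx n) (r : Idx n → ℤ) :
    ⁅wittDeg i, wittH r⁆ = (r i : ℂ) • wittH r := by
  rw [wittH, wittDeg, wittD_lie]
  apply derivation_ext
  intro m
  simp [toC, single_dotProduct]

lemma wittDeg_lie_wittDeg {n : ℕ} (i j : Idx n) : ⁅wittDeg i, wittDeg j⁆ = 0 := by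
  rw [wittDeg, wittDeg, wittD_lie]
  apply derivation_ext
  intro m
  simp

/-- The spanning family `H_r` (`r ≠ 0`), `d_i` of the Hamiltonian Lie algebra. -/
def hamFamily (n : ℕ) :
    {r : Idx n → ℤ // r ≠ 0} ⊕ Idx n → Derivation ℂ (Laurent n) (Laurent n) :=
  Sum.elim (fun r => wittH r.1) wittDeg

lemma wittH_mem {n : ℕ} (r : Idx n → ℤ) :
    wittH r ∈ Submodule.span ℂ (Set.range (hamFamily n)) := by
  by_cases h : r = 0
  · subst h; rw [wittH_zero]; exact Submodule.zero_mem _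
  · exact Submodule.subset_span ⟨Sum.inl ⟨r, h⟩, rfl⟩

/-- The Hamiltonian Lie algebra `𝔥_N`: the span of the `H_r`, `r ≠ 0`, and the `d_i`, as a Lie
subalgebra of the Witt algebra `Der(A_N)`. -/
def Ham (n : ℕ) : LieSubalgebra ℂ (Derivation ℂ (Laurent n) (Laurent n)) where
  toSubmodule := Submodule.span ℂ (Set.range (hamFamily n))
  lie_mem' := by
    intro x y hx hy
    change x ∈ Submodule.span ℂ (Set.range (hamFamily n)) at hx
    change y ∈ Submodule.span ℂ (Set.range (hamFamily n)) at hy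
    change ⁅x, y⁆ ∈ Submodule.span ℂ (Set.range (hamFamily n))
    induction hx, hy using Submodule.span_induction₂ with
    | mem_mem x y hx hy =>
      obtain ⟨a, rfl⟩ := hx
      obtain ⟨b, rfl⟩ := hy
      rcases a with r | i <;> rcases b with s | j
      · simp only [hamFamily, Sum.elim_inl, wittH_lie]
        exact Submodule.smul_mem _ _ (wittH_mem _)
      · simp only [hamFamily, Sum.elim_inl, Sum.elim_inr]
        rw [← lie_skew, wittDeg_lie_wittH]
        exact Submodule.neg_mem _ (Submodule.smul_mem _ _ (wittH_mem _))
      · simp only [hamFamily, Sum.elim_inl, Sum.elim_inr, wittDeg_lie_wittH]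
        exact Submodule.smul_mem _ _ (wittH_mem _)
      · simp only [hamFamily, Sum.elim_inr, wittDeg_lie_wittDeg]
        exact Submodule.zero_mem _
    | zero_left y _ =>
      have h := zero_lie (L := Derivation ℂ (Laurent n) (Laurent n)) y
      exact h.symm ▸ Submodule.zero_mem _
    | zero_right x _ =>
      have h := lie_zero (M := Derivation ℂ (Laurent n) (Laurent n)) x
      exact h.symm ▸ Submodule.zero_mem _
    | add_left x y z _ _ _ h1 h2 =>
      exact (add_lie x y z : ⁅x + y, z⁆ = _) ▸ Submodule.add_mem _ h1 h2
    | add_right x y z _ _ _ h1 h2 =>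
      exact (lie_add x y z : ⁅x, y + z⁆ = _) ▸ Submodule.add_mem _ h1 h2
    | smul_left c x y _ _ h => exact (smul_lie c x y : ⁅c • x, y⁆ = _) ▸ Submodule.smul_mem _ _ h
    | smul_right c x y _ _ h => exact (lie_smul c x y : ⁅x, c • y⁆ = _) ▸ Submodule.smul_mem _ _ h

/-- `H_r` as an element of the Hamiltonian Lie algebra. -/
def Ham.H {n : ℕ} (r : Idx n → ℤ) : Ham n := ⟨wittH r, wittH_mem r⟩

/-- `d_i` as an element of the Hamiltonian Lie algebra. -/
def Ham.d {n : ℕ} (i : Idx n) : Ham n :=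
  ⟨wittDeg i, Submodule.subset_span ⟨Sum.inr i, rfl⟩⟩

lemma hamFamily_linearIndependent (n : ℕ) : LinearIndependent ℂ (hamFamily n) := by
  classical
  have hb : ∀ r : {r : Idx n → ℤ // r ≠ 0}, bar (toC r.1) ⬝ᵥ toC (bar r.1) ≠ 0 := by
    rintro ⟨r, hr⟩ h
    apply hr
    have h1 : bar (toC r) ⬝ᵥ toC (bar r) = ((∑ i, bar r i * bar r i : ℤ) : ℂ) := by
      push_cast
      refine Finset.sum_congr rfl fun i _ => ?_
      rcases i with i | i <;> simp [bar, toC]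
    simp only at h
    rw [h1, Int.cast_eq_zero, Finset.sum_eq_zero_iff_of_nonneg fun i _ => mul_self_nonneg _] at h
    ext i
    rcases i with i | i
    · simpa [bar] using h (Sum.inr i) (Finset.mem_univ _)
    · simpa [bar] using h (Sum.inl i) (Finset.mem_univ _)
  -- the coefficient of `t^m` in `D(t^s)`, as a functional of `D`
  let φ : (s m : Idx n → ℤ) → Module.Dual ℂ (Derivation ℂ (Laurent n) (Laurent n)) := fun s m =>
    { toFun := fun D => (monoBasis n).coord m (D (mono s))
      map_add' := fun D E => by simp
      map_smul' := fun c D => by simp }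
  have hφ : ∀ s m u r, φ s m (wittD u r) = (u ⬝ᵥ toC s) * if r + s = m then 1 else 0 := by
    intro s m u r
    change (monoBasis n).coord m (wittD u r (mono s)) = _
    rw [wittD_mono, map_smul, ← monoBasis_apply, Module.Basis.coord_apply,
      Module.Basis.repr_self, Finsupp.single_apply, smul_eq_mul]
  refine LinearIndependent.of_pairwise_dual_eq_zero_one (hamFamily n)
    (Sum.elim (fun r => (bar (toC r.1) ⬝ᵥ toC (bar r.1))⁻¹ • φ (bar r.1) (r.1 + bar r.1))
      (fun i => φ (Pi.single i 1) (Pi.single i 1))) ?_ ?_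
  · rintro (r | i) (s | j) hne
    · have : ¬ s.1 = r.1 := fun h => hne (by rw [Subtype.ext h])
      simp [hamFamily, wittH, hφ, this]
    · have : ¬ (0 : Idx n → ℤ) = r.1 := fun h => r.2 h.symm
      simp [hamFamily, wittDeg, hφ, r.2]
    · simp [hamFamily, wittH, hφ, s.2]
    · have : i ≠ j := fun h => hne (by rw [h])
      simp [hamFamily, wittDeg, hφ, toC, this.symm]
  · rintro (r | i)
    · simp [hamFamily, wittH, hφ, hb r]
    · simp [hamFamily, wittDeg, hφ, toC]

/-- The basis `H_r` (`r ≠ 0`), `d_i` of the Hamiltonian Lie algebra. -/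
def Ham.basis (n : ℕ) : Module.Basis ({r : Idx n → ℤ // r ≠ 0} ⊕ Idx n) ℂ (Ham n) :=
  Module.Basis.span (hamFamily_linearIndependent n)

lemma Ham.basis_inl {n : ℕ} (r : {r : Idx n → ℤ // r ≠ 0}) :
    Ham.basis n (Sum.inl r) = Ham.H r.1 :=
  Module.Basis.span_apply (hamFamily_linearIndependent n) _

lemma Ham.basis_inr {n : ℕ} (i : Idx n) : Ham.basis n (Sum.inr i) = Ham.d i :=
  Module.Basis.span_apply (hamFamily_linearIndependent n) _

/-! ### The Shen-Larsson functor -/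

/-- The operator `v ⊗ t^s ↦ (s_i + β_i) v ⊗ t^s` on `V ⊗ A_N`. -/
def actDeg {n : ℕ} (V : Type*) [AddCommGroup V] [Module ℂ V] (β : Idx n → ℂ) (i : Idx n) :
    Module.End ℂ (V ⊗[ℂ] Laurent n) :=
  TensorProduct.map LinearMap.id (shiftOp 0 fun s => (s i : ℂ) + β i)

lemma actDeg_tmul {n : ℕ} {V : Type*} [AddCommGroup V] [Module ℂ V] (β : Idx n → ℂ) (i : Idx n) (s : Idx n → ℤ) (v : V) :
    actDeg V β i (v ⊗ₜ mono s) = ((s i : ℂ) + β i) • (v ⊗ₜ mono s) := by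
  simp only [actDeg, TensorProduct.map_tmul, shiftOp_mono, zero_add,
    LinearMap.id_apply, TensorProduct.tmul_smul]

lemma end_lie_apply {M : Type*} [AddCommGroup M] [Module ℂ M] (f g : Module.End ℂ M) (x : M) :
    ⁅f, g⁆ x = f (g x) - g (f x) := rfl

lemma tensor_end_ext {n : ℕ} {V : Type*} [AddCommGroup V] [Module ℂ V] {f g : Module.End ℂ (V ⊗[ℂ] Laurent n)}
    (h : ∀ (v : V) (s : Idx n → ℤ), f (v ⊗ₜ mono s) = g (v ⊗ₜ mono s)) : f = g := by
  refine TensorProduct.ext (LinearMap.ext fun v => (monoBasis n).ext fun s => ?_)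
  simpa using h v s

lemma actDeg_lie_actDeg {n : ℕ} {V : Type*} [AddCommGroup V] [Module ℂ V] (β : Idx n → ℂ) (i j : Idx n) :
    ⁅actDeg V β i, actDeg V β j⁆ = 0 := by
  apply tensor_end_ext
  intro v m
  rw [end_lie_apply, actDeg_tmul, map_smul, actDeg_tmul, map_smul, actDeg_tmul,
    smul_smul, smul_smul, mul_comm, sub_self, LinearMap.zero_apply]

section ShenLarsson

variable {n : ℕ} {V : Type*} [AddCommGroup V] [Module ℂ V] [LieRingModule (Sp n) V]
  [LieModule ℂ (Sp n) V]

/-- The operator `v ⊗ t^s ↦ ((r̄, s + α) I + r r̄ᵗ) v ⊗ t^{r+s}` on `V ⊗ A_N`. -/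
def actH (V : Type*) [AddCommGroup V] [Module ℂ V] [LieRingModule (Sp n) V]
    [LieModule ℂ (Sp n) V] (α : Idx n → ℂ) (r : Idx n → ℤ) :
    Module.End ℂ (V ⊗[ℂ] Laurent n) :=
  TensorProduct.map LinearMap.id (shiftOp r fun s => bar (toC r) ⬝ᵥ (toC s + α)) +
    TensorProduct.map (LieModule.toEnd ℂ (Sp n) V (rankOne (toC r))) (shiftOp r fun _ => 1)

lemma actH_tmul (α : Idx n → ℂ) (r s : Idx n → ℤ) (v : V) :
    actH V α r (v ⊗ₜ mono s) =
      ((bar (toC r) ⬝ᵥ (toC s + α)) • v + ⁅rankOne (toC r), v⁆) ⊗ₜ mono (r + s) := by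
  simp only [actH, LinearMap.add_apply, TensorProduct.map_tmul, shiftOp_mono, one_smul,
    LinearMap.id_apply, LieModule.toEnd_apply_apply, TensorProduct.add_tmul,
    TensorProduct.tmul_smul, TensorProduct.smul_tmul']

lemma rankOne_zero : rankOne (0 : Idx n → ℂ) = 0 := by
  apply Subtype.ext
  change Matrix.vecMulVec 0 (bar 0) = 0
  ext i j
  simp [Matrix.vecMulVec]

lemma actH_zero (α : Idx n → ℂ) : actH V α 0 = 0 := by
  apply tensor_end_ext
  intro v s
  have : bar (0 : Idx n → ℂ) = 0 := by ext i; rcases i with i | i <;> simp [bar]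
  simp [actH_tmul, this, rankOne_zero]

lemma actH_lie (α : Idx n → ℂ) (r s : Idx n → ℤ) :
    ⁅actH V α r, actH V α s⁆ = (bar (toC r) ⬝ᵥ toC s) • actH V α (r + s) := by
  apply tensor_end_ext
  intro v m
  have h := bar_dotProduct (toC s) (toC r)
  have hl : ⁅rankOne (toC r), ⁅rankOne (toC s), v⁆⁆ = ⁅⁅rankOne (toC r), rankOne (toC s)⁆, v⁆ +
      ⁅rankOne (toC s), ⁅rankOne (toC r), v⁆⁆ := leibniz_lie _ _ _
  rw [rankOne_lie, smul_lie, sub_lie, sub_lie] at hl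
  rw [LinearMap.smul_apply, end_lie_apply, actH_tmul, actH_tmul, actH_tmul, actH_tmul,
    actH_tmul, show r + (s + m) = r + s + m by abel, show s + (r + m) = r + s + m by abel,
    ← TensorProduct.sub_tmul, TensorProduct.smul_tmul']
  congr 1
  simp only [lie_add, lie_smul, hl, toC_add, bar_add, add_dotProduct, dotProduct_add, h]
  module

lemma actDeg_lie_actH (α β : Idx n → ℂ) (i : Idx n) (r : Idx n → ℤ) :
    ⁅actDeg V β i, actH V α r⁆ = (r i : ℂ) • actH V α r := by
  apply tensor_end_ext
  intro v m
  rw [LinearMap.smul_apply, end_lie_apply, actDeg_tmul, map_smul, actH_tmul, actDeg_tmul,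
    ← sub_smul]
  congr 1
  simp

/-- The linear map `𝔥_N → End (V ⊗ A_N)` with `H_r ↦ actH`, `d_i ↦ actDeg`. -/
def shenLarssonLinear (V : Type*) [AddCommGroup V] [Module ℂ V] [LieRingModule (Sp n) V]
    [LieModule ℂ (Sp n) V] (α β : Idx n → ℂ) : Ham n →ₗ[ℂ] Module.End ℂ (V ⊗[ℂ] Laurent n) :=
  (Ham.basis n).constr ℂ (Sum.elim (fun r => actH V α r.1) (actDeg V β))

lemma shenLarssonLinear_H (α β : Idx n → ℂ) (r : Idx n → ℤ) :
    shenLarssonLinear V α β (Ham.H r) = actH V α r := by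
  by_cases h : r = 0
  · subst h
    have : Ham.H (0 : Idx n → ℤ) = 0 := Subtype.ext wittH_zero
    rw [this, map_zero, actH_zero]
  · rw [show Ham.H r = Ham.basis n (Sum.inl ⟨r, h⟩) from (Ham.basis_inl ⟨r, h⟩).symm,
      shenLarssonLinear, Module.Basis.constr_basis, Sum.elim_inl]

lemma shenLarssonLinear_d (α β : Idx n → ℂ) (i : Idx n) :
    shenLarssonLinear V α β (Ham.d i) = actDeg V β i := by
  rw [← Ham.basis_inr, shenLarssonLinear, Module.Basis.constr_basis, Sum.elim_inr]

/-- The representation of `𝔥_N` on `V ⊗ A_N`. -/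
def shenLarssonRep (V : Type*) [AddCommGroup V] [Module ℂ V] [LieRingModule (Sp n) V]
    [LieModule ℂ (Sp n) V] (α β : Idx n → ℂ) : Ham n →ₗ⁅ℂ⁆ Module.End ℂ (V ⊗[ℂ] Laurent n) where
  toLinearMap := shenLarssonLinear V α β
  map_lie' := by
    set f := shenLarssonLinear V α β with hf
    have key : (LieModule.toEnd ℂ (Ham n) (Ham n)).toLinearMap.compr₂ f =
        ((LieModule.toEnd ℂ (Module.End ℂ (V ⊗[ℂ] Laurent n))
          (Module.End ℂ (V ⊗[ℂ] Laurent n))).toLinearMap.compl₂ f).comp f := by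
      refine (Ham.basis n).ext fun a => (Ham.basis n).ext fun b => ?_
      change f ⁅Ham.basis n a, Ham.basis n b⁆ = ⁅f (Ham.basis n a), f (Ham.basis n b)⁆
      rcases a with r | i <;> rcases b with s | j
      · have : ⁅Ham.H r.1, Ham.H s.1⁆ = (bar (toC r.1) ⬝ᵥ toC s.1) • Ham.H (r.1 + s.1) :=
          Subtype.ext (wittH_lie _ _)
        simp only [Ham.basis_inl, this, map_smul, hf, shenLarssonLinear_H, actH_lie]
      · have : ⁅Ham.d j, Ham.H r.1⁆ = (r.1 j : ℂ) • Ham.H r.1 :=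
          Subtype.ext (wittDeg_lie_wittH _ _)
        rw [Ham.basis_inl, Ham.basis_inr, ← lie_skew, this, map_neg, map_smul, hf,
          shenLarssonLinear_H, shenLarssonLinear_d, ← lie_skew, actDeg_lie_actH]
      · have : ⁅Ham.d i, Ham.H s.1⁆ = (s.1 i : ℂ) • Ham.H s.1 :=
          Subtype.ext (wittDeg_lie_wittH _ _)
        rw [Ham.basis_inl, Ham.basis_inr, this, map_smul, hf,
          shenLarssonLinear_H, shenLarssonLinear_d, actDeg_lie_actH]
      · have : ⁅Ham.d i, Ham.d j⁆ = 0 := Subtype.ext (wittDeg_lie_wittDeg _ _)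
        rw [Ham.basis_inr, Ham.basis_inr, this, map_zero, hf, shenLarssonLinear_d,
          shenLarssonLinear_d, actDeg_lie_actDeg]
    intro x y
    exact LinearMap.congr_fun₂ key x y

end ShenLarsson

/-- The module `F^{α,β}(V) = V ⊗ A_N`. -/
def ShenLarsson {n : ℕ} (_α _β : Idx n → ℂ) (V : Type*) [AddCommGroup V] [Module ℂ V] : Type _ :=
  V ⊗[ℂ] Laurent n

namespace ShenLarsson

variable {n : ℕ} (α β : Idx n → ℂ) (V : Type*) [AddCommGroup V] [Module ℂ V]

instance : AddCommGroup (ShenLarsson α β V) := inferInstanceAs (AddCommGroup (V ⊗[ℂ] Laurent n))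

instance : Module ℂ (ShenLarsson α β V) := inferInstanceAs (Module ℂ (V ⊗[ℂ] Laurent n))

variable {V} in
/-- The element `v ⊗ t^s` of `F^{α,β}(V)`. -/
def tmul (v : V) (s : Idx n → ℤ) : ShenLarsson α β V :=
  (v ⊗ₜ[ℂ] (mono s : Laurent n) : V ⊗[ℂ] Laurent n)

variable [LieRingModule (Sp n) V] [LieModule ℂ (Sp n) V]

instance : LieRingModule (Ham n) (ShenLarsson α β V) where
  bracket x w := shenLarssonRep V α β x w
  add_lie x y w := by
    change shenLarssonRep V α β (x + y) w = _
    rw [map_add]; rfl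
  lie_add x w w' := map_add (shenLarssonRep V α β x) w w'
  leibniz_lie x y w := by
    change shenLarssonRep V α β x (shenLarssonRep V α β y w) =
      shenLarssonRep V α β ⁅x, y⁆ w + shenLarssonRep V α β y (shenLarssonRep V α β x w)
    rw [LieHom.map_lie]
    exact (sub_add_cancel _ _).symm

instance : LieModule ℂ (Ham n) (ShenLarsson α β V) where
  smul_lie c x w := by
    change shenLarssonRep V α β (c • x) w = _
    rw [map_smul]; rfl
  lie_smul c x w := map_smul (shenLarssonRep V α β x) c w

variable {V}

lemma H_lie (r s : Idx n → ℤ) (v : V) :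
    ⁅Ham.H r, tmul α β v s⁆ =
      tmul α β ((bar (toC r) ⬝ᵥ (toC s + α)) • v + ⁅rankOne (toC r), v⁆) (r + s) := by
  change shenLarssonLinear V α β (Ham.H r) (v ⊗ₜ mono s) = _
  rw [shenLarssonLinear_H, actH_tmul]
  rfl

lemma d_lie (i : Idx n) (s : Idx n → ℤ) (v : V) :
    ⁅(Ham.d i : Ham n), tmul α β v s⁆ = ((s i : ℂ) + β i) • tmul α β v s := by
  change shenLarssonLinear V α β (Ham.d i) (v ⊗ₜ mono s) = _
  rw [shenLarssonLinear_d, actDeg_tmul]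
  rfl

end ShenLarsson

/-! ### Exterior powers of the natural module and the contraction maps -/

section Exterior

variable {n : ℕ}

/-- The exterior algebra of `ℂ^N`; its degree `k` part is `⋀[ℂ]^k (Idx n → ℂ)`. -/
abbrev Ext (n : ℕ) : Type := ExteriorAlgebra ℂ (Idx n → ℂ)

/-- The contraction (interior product) of an exterior form with the linear functional `φ`. -/
abbrev contract (φ : Module.Dual ℂ (Idx n → ℂ)) : Ext n →ₗ[ℂ] Ext n :=
  CliffordAlgebra.contractLeft (Q := 0) φ

lemma contract_ι_mul (φ : Module.Dual ℂ (Idx n → ℂ)) (v : Idx n → ℂ) (x : Ext n) :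
    contract φ (ExteriorAlgebra.ι ℂ v * x) = φ v • x - ExteriorAlgebra.ι ℂ v * contract φ x :=
  CliffordAlgebra.contractLeft_ι_mul _ _ _

lemma ext_left_induction {P : Ext n → Prop} (one : P 1) (add : ∀ x y, P x → P y → P (x + y))
    (smul : ∀ (c : ℂ) x, P x → P (c • x))
    (ι_mul : ∀ x v, P x → P (ExteriorAlgebra.ι ℂ v * x)) (x : Ext n) : P x :=
  CliffordAlgebra.left_induction (Q := 0)
    (fun c => by rw [Algebra.algebraMap_eq_smul_one]; exact smul c _ one) add ι_mul x

/-- The `j`-th coordinate functional. -/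
abbrev coordFun (j : Idx n) : Module.Dual ℂ (Idx n → ℂ) := LinearMap.proj j

/-- The action of a matrix `A` on the exterior algebra as the derivation
`v₁ ∧ ⋯ ∧ v_k ↦ ∑ᵢ v₁ ∧ ⋯ ∧ A vᵢ ∧ ⋯ ∧ v_k`, see `extAct_one` and `extAct_ι_mul`. -/
def extAct (A : Matrix (Idx n) (Idx n) ℂ) : Module.End ℂ (Ext n) :=
  ∑ j, (LinearMap.mulLeft ℂ (ExteriorAlgebra.ι ℂ (A *ᵥ Pi.single j 1))) ∘ₗ contract (coordFun j)

lemma extAct_one (A : Matrix (Idx n) (Idx n) ℂ) : extAct A 1 = 0 := by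
  simp [extAct, LinearMap.sum_apply, CliffordAlgebra.contractLeft_one]

lemma ι_mul_ι_swap (v w : Idx n → ℂ) (x : Ext n) :
    ExteriorAlgebra.ι ℂ v * (ExteriorAlgebra.ι ℂ w * x) =
      -(ExteriorAlgebra.ι ℂ w * (ExteriorAlgebra.ι ℂ v * x)) := by
  rw [← mul_assoc, ← mul_assoc, eq_neg_iff_add_eq_zero, ← add_mul, ExteriorAlgebra.ι_add_mul_swap,
    zero_mul]

lemma extAct_ι_mul (A : Matrix (Idx n) (Idx n) ℂ) (v : Idx n → ℂ) (x : Ext n) :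
    extAct A (ExteriorAlgebra.ι ℂ v * x) =
      ExteriorAlgebra.ι ℂ (A *ᵥ v) * x + ExteriorAlgebra.ι ℂ v * extAct A x := by
  have hv : A *ᵥ v = ∑ j, v j • A *ᵥ Pi.single j 1 := by
    ext i
    simp [Matrix.mulVec, dotProduct, mul_comm]
  conv_rhs => rw [hv]
  simp only [extAct, LinearMap.sum_apply, LinearMap.comp_apply, LinearMap.mulLeft_apply,
    contract_ι_mul, map_sum, Finset.sum_mul, Finset.mul_sum, ← Finset.sum_add_distrib]
  refine Finset.sum_congr rfl fun j _ => ?_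
  rw [mul_sub, ι_mul_ι_swap]
  simp

lemma extAct_unique {A : Matrix (Idx n) (Idx n) ℂ} {f : Module.End ℂ (Ext n)} (h1 : f 1 = 0)
    (h2 : ∀ v x, f (ExteriorAlgebra.ι ℂ v * x) =
      ExteriorAlgebra.ι ℂ (A *ᵥ v) * x + ExteriorAlgebra.ι ℂ v * f x) (x : Ext n) :
    f x = extAct A x := by
  induction x using ext_left_induction with
  | one => rw [h1, extAct_one]
  | add x y hx hy => rw [map_add, map_add, hx, hy]
  | smul c x hx => rw [map_smul, map_smul, hx]
  | ι_mul x v hx => rw [h2, extAct_ι_mul, hx]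

instance : LieRingModule (Matrix (Idx n) (Idx n) ℂ) (Ext n) where
  bracket A x := extAct A x
  add_lie A B x := by
    refine (extAct_unique (f := extAct A + extAct B) ?_ ?_ x).symm
    · simp [extAct_one]
    · intro v x
      simp only [LinearMap.add_apply, extAct_ι_mul, Matrix.add_mulVec, map_add, add_mul, mul_add]
      abel
  lie_add A x y := map_add _ _ _
  leibniz_lie A B x := by
    have := extAct_unique (A := ⁅A, B⁆)
      (f := extAct A ∘ₗ extAct B - extAct B ∘ₗ extAct A) (by simp [extAct_one]) (by
        intro v x
        simp only [LinearMap.sub_apply, LinearMap.comp_apply, extAct_ι_mul, Ring.lie_def,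
          Matrix.sub_mulVec, Matrix.mulVec_mulVec, map_add, map_sub, sub_mul, mul_sub]
        abel) x
    change extAct A (extAct B x) = extAct ⁅A, B⁆ x + extAct B (extAct A x)
    rw [← this]
    simp

instance : LieModule ℂ (Matrix (Idx n) (Idx n) ℂ) (Ext n) where
  smul_lie c A x := by
    refine (extAct_unique (f := c • extAct A) ?_ ?_ x).symm
    · simp [extAct_one]
    · intro v x
      simp [extAct_ι_mul, Matrix.smul_mulVec]
  lie_smul c A x := map_smul _ _ _

lemma lie_one (A : Matrix (Idx n) (Idx n) ℂ) : ⁅A, (1 : Ext n)⁆ = 0 := extAct_one A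

lemma lie_ι_mul (A : Matrix (Idx n) (Idx n) ℂ) (v : Idx n → ℂ) (x : Ext n) :
    ⁅A, ExteriorAlgebra.ι ℂ v * x⁆ =
      ExteriorAlgebra.ι ℂ ⁅A, v⁆ * x + ExteriorAlgebra.ι ℂ v * ⁅A, x⁆ :=
  extAct_ι_mul A v x

lemma lie_mem_exteriorPower (A : Matrix (Idx n) (Idx n) ℂ) (k : ℕ) {x : Ext n}
    (hx : x ∈ ⋀[ℂ]^k (Idx n → ℂ)) : ⁅A, x⁆ ∈ ⋀[ℂ]^k (Idx n → ℂ) := by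
  induction k generalizing x with
  | zero =>
    rw [ExteriorAlgebra.exteriorPower, pow_zero, Submodule.mem_one] at hx
    obtain ⟨c, rfl⟩ := hx
    rw [Algebra.algebraMap_eq_smul_one, lie_smul, lie_one, smul_zero]
    exact Submodule.zero_mem _
  | succ k ih =>
    rw [ExteriorAlgebra.exteriorPower, pow_succ'] at hx ⊢
    induction hx using Submodule.mul_induction_on' with
    | mem_mul_mem a ha b hb =>
      obtain ⟨v, rfl⟩ := ha
      rw [lie_ι_mul]
      exact Submodule.add_mem _ (Submodule.mul_mem_mul ⟨_, rfl⟩ hb)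
        (Submodule.mul_mem_mul ⟨_, rfl⟩ (ih hb))
    | add a _ b _ ha hb => rw [lie_add]; exact Submodule.add_mem _ ha hb

/-- The contraction `θ` on the exterior algebra. On the degree `j` part it is
`θ_j (v₁ ∧ ⋯ ∧ v_j) = ∑_{r<s} (-1)^{r+s-1} (v_r, v̄_s) v₁ ∧ ⋯ v̂_r ⋯ v̂_s ⋯ ∧ v_j`,
see `theta_ιMulti`. -/
def theta (n : ℕ) : Ext n →ₗ[ℂ] Ext n :=
  ∑ i : Fin n, contract (coordFun (Sum.inr i)) ∘ₗ contract (coordFun (Sum.inl i))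

/-- The functional `w ↦ (v, w̄)`. -/
def omega (v : Idx n → ℂ) : Module.Dual ℂ (Idx n → ℂ) :=
  ∑ i : Fin n, (v (Sum.inl i) • coordFun (Sum.inr i) - v (Sum.inr i) • coordFun (Sum.inl i))

lemma omega_apply (v w : Idx n → ℂ) : omega v w = v ⬝ᵥ bar w := by
  simp [omega, dotProduct, bar, LinearMap.sum_apply, sub_eq_add_neg, Finset.sum_add_distrib]

lemma theta_one : theta n 1 = 0 := by
  simp [theta, LinearMap.sum_apply, CliffordAlgebra.contractLeft_one]

lemma theta_ι_mul (v : Idx n → ℂ) (x : Ext n) :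
    theta n (ExteriorAlgebra.ι ℂ v * x) =
      contract (omega v) x + ExteriorAlgebra.ι ℂ v * theta n x := by
  simp only [theta, omega, LinearMap.sum_apply, LinearMap.comp_apply, contract_ι_mul, map_sum, map_sub,
    map_smul, LinearMap.sub_apply, LinearMap.smul_apply, Finset.mul_sum,
    ← Finset.sum_add_distrib, LinearMap.proj_apply]
  refine Finset.sum_congr rfl fun j _ => ?_
  abel

lemma contract_ιMulti (φ : Module.Dual ℂ (Idx n → ℂ)) (j : ℕ) (v : Fin (j + 1) → Idx n → ℂ) :
    contract φ (ExteriorAlgebra.ιMulti ℂ (j + 1) v) =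
      ∑ r : Fin (j + 1), ((-1) ^ (r : ℕ) * φ (v r)) •
        ExteriorAlgebra.ιMulti ℂ j (v ∘ r.succAbove) := by
  induction j with
  | zero =>
    simp [ExteriorAlgebra.ιMulti_succ_apply, CliffordAlgebra.contractLeft_ι,
      Algebra.algebraMap_eq_smul_one]
  | succ j ih =>
    rw [ExteriorAlgebra.ιMulti_succ_apply, contract_ι_mul, ih, Finset.mul_sum,
      Fin.sum_univ_succ (n := j + 1), sub_eq_add_neg, ← Finset.sum_neg_distrib]
    congr 1
    · simp only [Fin.val_zero, pow_zero, one_mul]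
      rfl
    · refine Finset.sum_congr rfl fun r _ => ?_
      rw [ExteriorAlgebra.ιMulti_succ_apply (v ∘ r.succ.succAbove), mul_smul_comm, ← neg_smul]
      congr 1
      · simp [Matrix.vecTail, pow_succ]
      · congr 2
        ext a b
        simp [Matrix.vecTail]

/-- The formula for the contraction map. Here the indices `r < s` of the usual formula,
which start at `1`, are the indices `r.castSucc < s.succ` for `r ≤ s` in `Fin (j + 1)`. -/
lemma theta_ιMulti (j : ℕ) (v : Fin (j + 2) → Idx n → ℂ) :
    theta n (ExteriorAlgebra.ιMulti ℂ (j + 2) v) =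
      ∑ r : Fin (j + 1), ∑ s : Fin (j + 1), if r ≤ s then
        ((-1) ^ ((r : ℕ) + s) * (v r.castSucc ⬝ᵥ bar (v s.succ))) •
          ExteriorAlgebra.ιMulti ℂ j (v ∘ s.succ.succAbove ∘ r.succAbove) else 0 := by
  induction j with
  | zero =>
    rw [ExteriorAlgebra.ιMulti_succ_apply, theta_ι_mul, ExteriorAlgebra.ιMulti_succ_apply]
    simp only [theta_ι_mul, contract_ι_mul]
    simp [theta_one, CliffordAlgebra.contractLeft_one, omega_apply, Matrix.vecTail]
  | succ j ih =>
    rw [ExteriorAlgebra.ιMulti_succ_apply, theta_ι_mul, ih, contract_ιMulti,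
      Finset.mul_sum]
    conv_rhs => rw [Fin.sum_univ_succ]
    congr 1
    · refine Finset.sum_congr rfl fun s _ => ?_
      rw [if_pos (Fin.zero_le s), omega_apply]
      congr 1
      · simp [Matrix.vecTail]
      · congr 1
        ext a b
        simp [Matrix.vecTail]
    · refine Finset.sum_congr rfl fun r _ => ?_
      conv_rhs => rw [Fin.sum_univ_succ]
      rw [if_neg (by simp), zero_add, Finset.mul_sum]
      refine Finset.sum_congr rfl fun s _ => ?_
      simp only [Fin.succ_le_succ_iff]
      split_ifs
      · rw [ExteriorAlgebra.ιMulti_succ_apply, mul_smul_comm]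
        congr 1
        · simp only [Matrix.vecTail, Function.comp_apply, Fin.val_succ, Fin.castSucc_succ]
          ring
        · congr 2
          ext a b
          simp [Matrix.vecTail]
      · simp

lemma omega_lie (A : Sp n) (v w : Idx n → ℂ) : omega ⁅A, v⁆ w = -omega v ⁅A, w⁆ := by
  have hJ : ∀ u : Idx n → ℂ, bar u = -(Matrix.J (Fin n) ℂ *ᵥ u) := by
    intro u
    ext i
    rcases i with i | i <;> simp [bar, Matrix.J, Matrix.fromBlocks_mulVec, Matrix.neg_mulVec]
  have hA : (A : Matrix (Idx n) (Idx n) ℂ)ᵀ * Matrix.J (Fin n) ℂ = Matrix.J (Fin n) ℂ * -A := by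
    have := A.2
    change _ ∈ skewAdjointMatricesLieSubalgebra _ at this
    rw [mem_skewAdjointMatricesLieSubalgebra, mem_skewAdjointMatricesSubmodule] at this
    exact this
  change omega ((A : Matrix (Idx n) (Idx n) ℂ) *ᵥ v) w =
    -omega v ((A : Matrix (Idx n) (Idx n) ℂ) *ᵥ w)
  rw [omega_apply, omega_apply, hJ, hJ, dotProduct_neg, dotProduct_neg, neg_neg,
    Matrix.mulVec_mulVec, dotProduct_comm, Matrix.dotProduct_mulVec, dotProduct_comm,
    ← Matrix.mulVec_transpose, Matrix.mulVec_mulVec, hA, Matrix.mul_neg, Matrix.neg_mulVec,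
    dotProduct_neg, neg_neg]

lemma contract_lie (A : Matrix (Idx n) (Idx n) ℂ) (φ ψ : Module.Dual ℂ (Idx n → ℂ))
    (h : ∀ w, ψ w = -φ ⁅A, w⁆) (x : Ext n) :
    contract φ ⁅A, x⁆ = ⁅A, contract φ x⁆ - contract ψ x := by
  induction x using ext_left_induction with
  | one => simp [lie_one, CliffordAlgebra.contractLeft_one]
  | add x y hx hy => simp only [lie_add, map_add, hx, hy]; abel
  | smul c x hx => simp only [lie_smul, map_smul, hx, smul_sub]
  | ι_mul x v hx =>
    rw [lie_ι_mul, map_add, contract_ι_mul, contract_ι_mul, contract_ι_mul, contract_ι_mul, hx, h,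
      lie_sub, lie_smul, lie_ι_mul, mul_sub, neg_smul]
    abel

/-- The contraction is a homomorphism of `𝔰𝔭_N`-modules. -/
lemma theta_lie (A : Sp n) (x : Ext n) : theta n ⁅A, x⁆ = ⁅A, theta n x⁆ := by
  change theta n ⁅(A : Matrix (Idx n) (Idx n) ℂ), x⁆ = ⁅(A : Matrix (Idx n) (Idx n) ℂ), theta n x⁆
  induction x using ext_left_induction with
  | one => simp [lie_one, theta_one]
  | add x y hx hy => simp only [lie_add, map_add, hx, hy]
  | smul c x hx => simp only [lie_smul, map_smul, hx]
  | ι_mul x v hx =>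
    rw [lie_ι_mul, map_add, theta_ι_mul, theta_ι_mul, theta_ι_mul, lie_add, lie_ι_mul, hx,
      contract_lie _ (omega v) (omega ⁅(A : Matrix (Idx n) (Idx n) ℂ), v⁆)
        (fun w => omega_lie A v w)]
    abel

/-- `Ker θ_k ⊆ ⋀^k ℂ^N` as an `𝔰𝔭_N`-module. -/
def kerTheta (n k : ℕ) : LieSubmodule ℂ (Sp n) (Ext n) where
  toSubmodule := ⋀[ℂ]^k (Idx n → ℂ) ⊓ LinearMap.ker (theta n)
  lie_mem := by
    intro A x hx
    refine ⟨lie_mem_exteriorPower _ k hx.1, ?_⟩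
    have h : theta n x = 0 := hx.2
    change theta n ⁅A, x⁆ = 0
    rw [theta_lie, h]
    exact lie_zero A

/-- The subspace `v ∧ ⋀^{k-1} ℂ^N` of `⋀^k ℂ^N`. -/
def wedgeWith (k : ℕ) (v : Idx n → ℂ) : Submodule ℂ (Ext n) :=
  (⋀[ℂ]^(k - 1) (Idx n → ℂ)).map (LinearMap.mulLeft ℂ (ExteriorAlgebra.ι ℂ v))

end Exterior

/-- An `𝔥_N`-module is reducible if it has a submodule that is neither zero nor everything. -/
def IsReducible (n : ℕ) (M : Type*) [AddCommGroup M] [Module ℂ M] [LieRingModule (Ham n) M] :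
    Prop :=
  ∃ P : LieSubmodule ℂ (Ham n) M, P ≠ ⊥ ∧ P ≠ ⊤

end Hamiltonian

end

open Hamiltonian

/-! The proof joins a computation that produces the submodules to an identification of `V(δ_k)` with
`Ker θ_k`.

The computation. In degree `s` put `u = s + α`; there `H_r` acts by `(r̄, u) + A` with `A = r r̄ᵗ`,
and the new degree has `r + u` in place of `u`. On the natural module `A u = (r̄, u) r`, so `u` goes
to `(r̄, u) (r + u)`, and the lines through the vectors `u` are carried into one another. On
exterior powers `A` is a derivation, and it is also the contraction with `r̄` followed by `r ∧ _`.
Hence `r ∧ A y = 0`, which gives `(r̄, u) u ∧ y + A (u ∧ y) = (r + u) ∧ ((r̄, u) y + A y)`. If `u =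
0`, the scalar term vanishes and `A w` lies in `r ∧ ⋀^{k-1}`, so such a degree may carry all of `Ker
θ_k`. See `smul_add_lie_mem_wedgeWith` and `rankOne_lie_mem_wedgeWith`. That the submodule is
nonzero and proper is tested in a single degree where the coordinate `u_{n+1}` is nonzero.

The identification. Irreducible modules with highest weight vectors `v`, `w` of the same weight are
isomorphic, because the submodule of the product generated by `(v, w)` is the graph of an
isomorphism (`nonempty_equiv_of_highestWeight`). It remains to see that `Ker θ_k` is irreducible
(`kerTheta_isIrreducible`). With creation and annihilation operators one checks that, for `k ≤ n`,
the vectors of `Ker θ_k` killed by the positive root vectors are the multiples of one vector `w`,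
which is `e_1 ∧ ⋯ ∧ e_k` up to a scalar (`annihilation_inr_eq_zero`, `mem_occSpace_firstIdx`). Every
nonzero submodule contains such a vector, hence `w`. Complete reducibility is replaced by a bilinear
form under which `X` and `Xᵗ` are adjoint: orthogonal complements of submodules are submodules.
Since `(w, w) = 1`, the complement of a nonzero submodule misses `w` and so is zero, which forces
the submodule to be everything. -/

noncomputable section

set_option linter.unusedSectionVars false

namespace Hamiltonian

/-! ### Uniqueness of irreducible highest weight modules -/

section HighestWeight

variable {L : Type*} [LieRing L] [LieAlgebra ℂ L]

/-- The product of two Lie modules. -/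
instance prodLieRingModule {M N : Type*} [AddCommGroup M] [LieRingModule L M] [AddCommGroup N]
    [LieRingModule L N] : LieRingModule L (M × N) where
  bracket x p := (⁅x, p.1⁆, ⁅x, p.2⁆)
  add_lie x y p := Prod.ext (add_lie x y p.1) (add_lie x y p.2)
  lie_add x p q := Prod.ext (lie_add x p.1 q.1) (lie_add x p.2 q.2)
  leibniz_lie x y p := Prod.ext (leibniz_lie x y p.1) (leibniz_lie x y p.2)

lemma lie_prod {M N : Type*} [AddCommGroup M] [LieRingModule L M] [AddCommGroup N]
    [LieRingModule L N] (x : L) (p : M × N) : ⁅x, p⁆ = (⁅x, p.1⁆, ⁅x, p.2⁆) := rfl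

instance prodLieModule {M N : Type*} [AddCommGroup M] [Module ℂ M] [LieRingModule L M]
    [LieModule ℂ L M] [AddCommGroup N] [Module ℂ N] [LieRingModule L N] [LieModule ℂ L N] :
    LieModule ℂ L (M × N) where
  smul_lie c x p := Prod.ext (smul_lie c x p.1) (smul_lie c x p.2)
  lie_smul c x p := Prod.ext (lie_smul c x p.1) (lie_smul c x p.2)

variable {M : Type*} [AddCommGroup M] [Module ℂ M] [LieRingModule L M] [LieModule ℂ L M]

/-- The vectors obtained from `v` by applying elements of `S` repeatedly. -/
inductive Descendant (S : Set L) (v : M) : M → Prop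
  | base : Descendant S v v
  | add {u w : M} : Descendant S v u → Descendant S v w → Descendant S v (u + w)
  | smul (c : ℂ) {u : M} : Descendant S v u → Descendant S v (c • u)
  | lie {x : L} {u : M} : x ∈ S → Descendant S v u → Descendant S v ⁅x, u⁆

lemma Descendant.zero (S : Set L) (v : M) : Descendant S v 0 := by
  simpa using Descendant.smul 0 (.base (S := S) (v := v))

lemma Descendant.neg {S : Set L} {v u : M} (h : Descendant S v u) : Descendant S v (-u) := by
  simpa using Descendant.smul (-1) h

lemma Descendant.lie_span {S : Set L} {v u : M} (h : Descendant S v u) {x : L}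
    (hx : x ∈ Submodule.span ℂ S) : Descendant S v ⁅x, u⁆ := by
  induction hx using Submodule.span_induction with
  | mem x hx => exact .lie hx h
  | zero => rw [zero_lie]; exact .zero S v
  | add x y _ _ hx hy => rw [add_lie]; exact hx.add hy
  | smul c x _ hx => rw [smul_lie]; exact hx.smul c

/-- If `L` is spanned by `S` and `T`, and `v` is an eigenvector of the elements of `T`, then
the submodule generated by `v` is obtained by applying elements of `S` only. -/
lemma Descendant.lie_mem {S T : Set L} (hST : Submodule.span ℂ S ⊔ Submodule.span ℂ T = ⊤)
    {v : M} (hT : ∀ b ∈ T, ∃ c : ℂ, ⁅b, v⁆ = c • v) {u : M} (h : Descendant S v u) (x : L) :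
    Descendant S v ⁅x, u⁆ := by
  induction h generalizing x with
  | base =>
    obtain ⟨s, hs, t, ht, rfl⟩ := Submodule.mem_sup.1 (hST ▸ Submodule.mem_top : x ∈ _)
    rw [add_lie]
    refine .add (Descendant.base.lie_span hs) ?_
    clear hs
    induction ht using Submodule.span_induction with
    | mem b hb => obtain ⟨c, hc⟩ := hT b hb; rw [hc]; exact .smul c .base
    | zero => rw [zero_lie]; exact .zero S v
    | add x y _ _ hx hy => rw [add_lie]; exact hx.add hy
    | smul c x _ hx => rw [smul_lie]; exact hx.smul c
  | add _ _ h1 h2 => rw [lie_add]; exact (h1 x).add (h2 x)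
  | smul c _ h1 => rw [lie_smul]; exact (h1 x).smul c
  -- The bracket of `x` with an element of `S` is again an arbitrary element of `L`, so the
  -- induction must range over all `x` at once.
  | lie hy _ ih => rw [leibniz_lie]; exact (ih _).add (.lie hy (ih x))

/-- Elements of `S` lower the `h`-eigenvalue by positive integers, so apart from a multiple of `v`
only eigenvalues strictly below `c` occur. -/
lemma Descendant.exists_sub_mem {S : Set L} {h : L} {v : M} {c : ℂ} (hv : ⁅h, v⁆ = c • v)
    (hS : ∀ x ∈ S, ∃ m : ℕ, 0 < m ∧ ⁅h, x⁆ = (-(m : ℂ)) • x) {u : M} (hu : Descendant S v u) :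
    ∃ a : ℂ, u - a • v ∈ ⨆ μ ≠ c, (LieModule.toEnd ℂ L M h).eigenspace μ := by
  set T := LieModule.toEnd ℂ L M h with hT
  -- The eigenvalues `c - 1, c - 2, …` form a set stable under lowering; the condition `μ ≠ c` alone
  -- would not survive the induction.
  suffices H : ∃ a : ℂ, u - a • v ∈ ⨆ m : ℕ, T.eigenspace (c - (m + 1 : ℕ)) by
    obtain ⟨a, ha⟩ := H
    refine ⟨a, (iSup_le fun m => ?_ : (⨆ m : ℕ, T.eigenspace (c - (m + 1 : ℕ))) ≤ _) ha⟩
    refine le_iSup₂_of_le (c - (m + 1 : ℕ)) ?_ le_rfl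
    rw [ne_eq, sub_eq_self, Nat.cast_eq_zero]
    omega
  have shift : ∀ (x : L) (m : ℕ) (μ : ℂ) (w : M), ⁅h, x⁆ = (-(m : ℂ)) • x →
      w ∈ T.eigenspace μ → ⁅x, w⁆ ∈ T.eigenspace (μ - m) := by
    intro x m μ w hx hw
    rw [Module.End.mem_eigenspace_iff] at hw ⊢
    rw [hT, LieModule.toEnd_apply_apply] at hw ⊢
    rw [leibniz_lie, hx, hw, lie_smul, smul_lie, ← add_smul]
    congr 1; ring
  induction hu with
  | base => exact ⟨1, by simp⟩
  | add _ _ h1 h2 =>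
    obtain ⟨a, ha⟩ := h1
    obtain ⟨b, hb⟩ := h2
    refine ⟨a + b, ?_⟩
    convert Submodule.add_mem _ ha hb using 1
    module
  | smul d _ h1 =>
    obtain ⟨a, ha⟩ := h1
    refine ⟨d * a, ?_⟩
    convert Submodule.smul_mem _ d ha using 1
    module
  | @lie x u hx _ ih =>
    obtain ⟨a, ha⟩ := ih
    obtain ⟨m, hm, hxm⟩ := hS x hx
    -- After one more lowering step no component of eigenvalue `c` is left.
    refine ⟨0, ?_⟩
    rw [zero_smul, sub_zero]
    have h1 : ⁅x, v⁆ ∈ ⨆ m : ℕ, T.eigenspace (c - (m + 1 : ℕ)) := by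
      have := shift x m c v hxm (Module.End.mem_eigenspace_iff.2 hv)
      refine Submodule.mem_iSup_of_mem (m - 1) ?_
      rwa [Nat.sub_add_cancel hm]
    have h2 : ∀ w ∈ ⨆ m : ℕ, T.eigenspace (c - (m + 1 : ℕ)),
        ⁅x, w⁆ ∈ ⨆ m : ℕ, T.eigenspace (c - (m + 1 : ℕ)) := by
      intro w hw
      induction hw using Submodule.iSup_induction' with
      | mem i w hw =>
        have := shift x m _ w hxm hw
        refine Submodule.mem_iSup_of_mem (i + m) ?_
        convert this using 2
        push_cast; ring
      | zero => rw [lie_zero]; exact Submodule.zero_mem _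
      | add w w' _ _ h h' => rw [lie_add]; exact Submodule.add_mem _ h h'
    have : ⁅x, u⁆ = ⁅x, u - a • v⁆ + a • ⁅x, v⁆ := by rw [lie_sub, lie_smul]; abel
    rw [this]
    exact Submodule.add_mem _ (h2 _ ha) (Submodule.smul_mem _ _ h1)

/-- The weight space of the highest weight is spanned by the highest weight vector. -/
lemma Descendant.eq_smul {S : Set L} {h : L} {v : M} {c : ℂ} (hv : ⁅h, v⁆ = c • v)
    (hS : ∀ x ∈ S, ∃ m : ℕ, 0 < m ∧ ⁅h, x⁆ = (-(m : ℂ)) • x) {u : M} (hu : Descendant S v u)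
    (huc : ⁅h, u⁆ = c • u) : ∃ a : ℂ, u = a • v := by
  obtain ⟨a, ha⟩ := hu.exists_sub_mem hv hS
  refine ⟨a, sub_eq_zero.1 ?_⟩
  have hd := (Module.End.eigenspaces_iSupIndep (LieModule.toEnd ℂ L M h)) c
  refine Submodule.disjoint_def.1 hd _ ?_ ha
  rw [Module.End.mem_eigenspace_iff, LieModule.toEnd_apply_apply, lie_sub, lie_smul, huc, hv]
  module

/-- This makes the submodule generated by `(v, w)` single-valued. The `y` with `(0, y)` in it form a
submodule of `N`; if that is nonzero it contains `w`. Then `(0, w)` has the `h`-eigenvalue of `(v,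
w)`, so it is a multiple of `(v, w)`, which is impossible as `v` and `w` are nonzero. -/
lemma eq_zero_of_prod_descendant {S T : Set L} {h : L} {N : Type*} [AddCommGroup N] [Module ℂ N]
    [LieRingModule L N] [LieModule ℂ L N] (hN : LieModule.IsIrreducible ℂ L N)
    (hST : Submodule.span ℂ S ⊔ Submodule.span ℂ T = ⊤)
    (hS : ∀ x ∈ S, ∃ m : ℕ, 0 < m ∧ ⁅h, x⁆ = (-(m : ℂ)) • x) (hh : h ∈ T)
    {v : M} {w : N} (hv0 : v ≠ 0) (hw0 : w ≠ 0)
    (hT : ∀ b ∈ T, ∃ c : ℂ, ⁅b, v⁆ = c • v ∧ ⁅b, w⁆ = c • w) {y : N}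
    (hy : Descendant S (v, w) ((0, y) : M × N)) : y = 0 := by
  have hT' : ∀ b ∈ T, ∃ c : ℂ, ⁅b, (v, w)⁆ = c • (v, w) := fun b hb => by
    obtain ⟨c, h1, h2⟩ := hT b hb
    exact ⟨c, Prod.ext h1 h2⟩
  by_contra hne
  let P : LieSubmodule ℂ L N :=
    { carrier := {y | Descendant S (v, w) ((0, y) : M × N)}
      add_mem' := fun {a b} ha hb => by simpa using ha.add hb
      zero_mem' := Descendant.zero S _
      smul_mem' := fun c a ha => by simpa using ha.smul c
      lie_mem := fun {x a} ha => by
        have := ha.lie_mem hST hT' x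
        rw [lie_prod] at this
        simpa using this }
  have hP : P = ⊤ := by
    refine (hN.eq_bot_or_eq_top P).resolve_left ?_
    rw [LieSubmodule.eq_bot_iff]
    exact fun H => hne (H y hy)
  have hw : Descendant S (v, w) ((0, w) : M × N) := (hP ▸ LieSubmodule.mem_top w : w ∈ P)
  obtain ⟨c, h1, h2⟩ := hT h hh
  obtain ⟨a, ha⟩ := hw.eq_smul (h := h) (c := c) (Prod.ext h1 h2) hS
    (Prod.ext (by simp [lie_prod]) h2)
  rw [Prod.smul_mk, Prod.mk.injEq] at ha
  have : a = 0 := (smul_eq_zero.1 ha.1.symm).resolve_right hv0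
  exact hw0 (by rw [ha.2, this, zero_smul])

lemma Descendant.swap {S : Set L} {N : Type*} [AddCommGroup N] [Module ℂ N]
    [LieRingModule L N] [LieModule ℂ L N] {p q : M × N} (h : Descendant S p q) :
    Descendant S p.swap q.swap := by
  induction h with
  | base => exact .base
  | add _ _ h1 h2 => exact h1.add h2
  | smul c _ h1 => exact h1.smul c
  | lie hx _ h1 => exact h1.lie hx

/-- The first projection of the submodule generated by `(v, w)` is a submodule of `M` containing `v
≠ 0`, hence all of `M`. -/
lemma exists_prod_descendant {S T : Set L} {N : Type*} [AddCommGroup N] [Module ℂ N]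
    [LieRingModule L N] [LieModule ℂ L N] (hM : LieModule.IsIrreducible ℂ L M)
    (hST : Submodule.span ℂ S ⊔ Submodule.span ℂ T = ⊤)
    {v : M} {w : N} (hv0 : v ≠ 0)
    (hT : ∀ b ∈ T, ∃ c : ℂ, ⁅b, v⁆ = c • v ∧ ⁅b, w⁆ = c • w) (x : M) :
    ∃ y : N, Descendant S (v, w) (x, y) := by
  have hT' : ∀ b ∈ T, ∃ c : ℂ, ⁅b, (v, w)⁆ = c • (v, w) := fun b hb => by
    obtain ⟨c, h1, h2⟩ := hT b hb
    exact ⟨c, Prod.ext h1 h2⟩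
  let P : LieSubmodule ℂ L M :=
    { carrier := {x | ∃ y : N, Descendant S (v, w) (x, y)}
      add_mem' := fun {a b} ⟨y, hy⟩ ⟨z, hz⟩ => ⟨y + z, hy.add hz⟩
      zero_mem' := ⟨0, Descendant.zero S _⟩
      smul_mem' := fun c a ⟨y, hy⟩ => ⟨c • y, hy.smul c⟩
      lie_mem := fun {x a} ⟨y, hy⟩ => ⟨⁅x, y⁆, hy.lie_mem hST hT' x⟩ }
  have hP : P = ⊤ := by
    refine (hM.eq_bot_or_eq_top P).resolve_left ?_
    rw [LieSubmodule.eq_bot_iff]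
    exact fun H => hv0 (H v ⟨w, .base⟩)
  exact (hP ▸ LieSubmodule.mem_top x : x ∈ P)

/-- Two irreducible modules with highest weight vectors of the same weight are isomorphic. -/
theorem nonempty_equiv_of_highestWeight {S T : Set L} {h : L} {N : Type*} [AddCommGroup N]
    [Module ℂ N] [LieRingModule L N] [LieModule ℂ L N]
    (hM : LieModule.IsIrreducible ℂ L M) (hN : LieModule.IsIrreducible ℂ L N)
    (hST : Submodule.span ℂ S ⊔ Submodule.span ℂ T = ⊤)
    (hS : ∀ x ∈ S, ∃ m : ℕ, 0 < m ∧ ⁅h, x⁆ = (-(m : ℂ)) • x) (hh : h ∈ T)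
    {v : M} {w : N} (hv0 : v ≠ 0) (hw0 : w ≠ 0)
    (hT : ∀ b ∈ T, ∃ c : ℂ, ⁅b, v⁆ = c • v ∧ ⁅b, w⁆ = c • w) :
    Nonempty (M ≃ₗ⁅ℂ, L⁆ N) := by
  have hT' : ∀ b ∈ T, ∃ c : ℂ, ⁅b, (v, w)⁆ = c • (v, w) := fun b hb => by
    obtain ⟨c, h1, h2⟩ := hT b hb
    exact ⟨c, Prod.ext h1 h2⟩
  have hT2 : ∀ b ∈ T, ∃ c : ℂ, ⁅b, w⁆ = c • w ∧ ⁅b, v⁆ = c • v := fun b hb => by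
    obtain ⟨c, h1, h2⟩ := hT b hb
    exact ⟨c, h2, h1⟩
  have uniq : ∀ {x y z}, Descendant S (v, w) (x, y) → Descendant S (v, w) (x, z) → y = z := by
    intro x y z hy hz
    refine sub_eq_zero.1 (eq_zero_of_prod_descendant hN hST hS hh hv0 hw0 hT ?_)
    simpa [sub_eq_add_neg] using hy.add hz.neg
  have uniq' : ∀ {x y z}, Descendant S (v, w) (y, x) → Descendant S (v, w) (z, x) → y = z := by
    intro x y z hy hz
    refine sub_eq_zero.1 (eq_zero_of_prod_descendant hM hST hS hh hw0 hv0 hT2 ?_)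
    simpa [sub_eq_add_neg] using hy.swap.add hz.swap.neg
  -- The generated submodule is now a bijective correspondence; `f` and `g` read it in the two
  -- directions, and linearity and equivariance follow from uniqueness of partners.
  choose f hf using exists_prod_descendant (S := S) hM hST (w := w) hv0 hT
  choose g hg using exists_prod_descendant (S := S) hN hST (w := v) hw0 hT2
  exact ⟨{
    toFun := f
    map_add' := fun x y => uniq (hf _) ((hf x).add (hf y))
    map_smul' := fun c x => uniq (hf _) ((hf x).smul c)
    map_lie' := fun {x m} => uniq (hf _) ((hf m).lie_mem hST hT' x)
    invFun := g
    left_inv := fun x => uniq' (hg (f x)).swap (hf x)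
    right_inv := fun y => uniq (hf (g y)) (hg y).swap }⟩

end HighestWeight

/-! ### Creation and annihilation operators on the exterior algebra -/

section Fock

variable {n : ℕ}

/-- Exterior multiplication by the basis vector `j`. -/
def creation (j : Idx n) : Module.End ℂ (Ext n) :=
  LinearMap.mulLeft ℂ (ExteriorAlgebra.ι ℂ (Pi.single j 1))

/-- Contraction with the coordinate functional `j`. -/
def annihilation (j : Idx n) : Module.End ℂ (Ext n) := contract (coordFun j)

/-- The occupation number operator of the basis vector `j`. -/
def numOp (j : Idx n) : Module.End ℂ (Ext n) := creation j * annihilation j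

lemma numOp_apply (j : Idx n) (x : Ext n) : numOp j x = creation j (annihilation j x) := rfl

lemma creation_apply (j : Idx n) (x : Ext n) :
    creation j x = ExteriorAlgebra.ι ℂ (Pi.single j 1) * x := rfl

lemma ι_mul_eq_sum (v : Idx n → ℂ) (x : Ext n) :
    ExteriorAlgebra.ι ℂ v * x = ∑ j, v j • creation j x := by
  conv_lhs => rw [pi_eq_sum_univ' v]
  simp only [map_sum, Finset.sum_mul, map_smul, smul_mul_assoc, creation_apply]

lemma creation_creation (i j : Idx n) (x : Ext n) :
    creation i (creation j x) = -creation j (creation i x) := ι_mul_ι_swap _ _ x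

lemma creation_creation_self (j : Idx n) (x : Ext n) : creation j (creation j x) = 0 := by
  rw [creation_apply, creation_apply, ← mul_assoc, ExteriorAlgebra.ι_sq_zero, zero_mul]

lemma annihilation_annihilation (i j : Idx n) (x : Ext n) :
    annihilation i (annihilation j x) = -annihilation j (annihilation i x) :=
  CliffordAlgebra.contractLeft_comm _ _ _

lemma annihilation_annihilation_self (j : Idx n) (x : Ext n) :
    annihilation j (annihilation j x) = 0 :=
  CliffordAlgebra.contractLeft_contractLeft _ x

/-- The canonical anticommutation relation, that is, the antiderivation rule for contractions. With
the two anticommutation rules above it yields all identities for the `numOp j`, which are commuting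
idempotents. -/
lemma annihilation_creation (i j : Idx n) (x : Ext n) :
    annihilation i (creation j x) = (if i = j then x else 0) - creation j (annihilation i x) := by
  change contract _ (ExteriorAlgebra.ι ℂ _ * x) = _
  rw [contract_ι_mul]
  simp only [LinearMap.proj_apply, Pi.single_apply, ite_smul, one_smul, zero_smul]
  rfl

lemma annihilation_creation_self (j : Idx n) (x : Ext n) :
    annihilation j (creation j x) = x - numOp j x := by
  rw [annihilation_creation, if_pos rfl]; rfl

lemma annihilation_creation_of_ne {i j : Idx n} (h : i ≠ j) (x : Ext n) :
    annihilation i (creation j x) = -creation j (annihilation i x) := by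
  rw [annihilation_creation, if_neg h, zero_sub]

lemma numOp_creation_of_ne {i j : Idx n} (h : i ≠ j) (x : Ext n) :
    numOp i (creation j x) = creation j (numOp i x) := by
  rw [numOp_apply, annihilation_creation_of_ne h, map_neg, creation_creation, neg_neg]; rfl

lemma numOp_annihilation_of_ne {i j : Idx n} (h : i ≠ j) (x : Ext n) :
    numOp i (annihilation j x) = annihilation j (numOp i x) := by
  rw [numOp_apply, numOp_apply, annihilation_creation_of_ne h.symm, annihilation_annihilation,
    map_neg]

lemma numOp_creation_self (j : Idx n) (x : Ext n) : numOp j (creation j x) = creation j x := by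
  rw [numOp_apply, annihilation_creation_self, numOp_apply, map_sub, creation_creation_self,
    sub_zero]

lemma numOp_annihilation_self (j : Idx n) (x : Ext n) : numOp j (annihilation j x) = 0 := by
  rw [numOp_apply, annihilation_annihilation_self, map_zero]

lemma creation_numOp_self (j : Idx n) (x : Ext n) : creation j (numOp j x) = 0 :=
  creation_creation_self _ _

lemma annihilation_numOp_self (j : Idx n) (x : Ext n) :
    annihilation j (numOp j x) = annihilation j x := by
  rw [numOp_apply, annihilation_creation_self, numOp_annihilation_self, sub_zero]

lemma numOp_numOp_self (j : Idx n) (x : Ext n) : numOp j (numOp j x) = numOp j x := by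
  rw [numOp_apply j x, numOp_creation_self]

lemma numOp_comm (i j : Idx n) (x : Ext n) : numOp i (numOp j x) = numOp j (numOp i x) := by
  by_cases h : i = j
  · rw [h]
  · rw [numOp_apply j x, numOp_creation_of_ne h, numOp_annihilation_of_ne h]; rfl

/-- The joint eigenspace of the occupation number operators with occupied set `S`. -/
def occSpace (S : Finset (Idx n)) : Submodule ℂ (Ext n) where
  carrier := {x | ∀ j, numOp j x = if j ∈ S then x else 0}
  add_mem' := fun {x y} hx hy j => by rw [map_add, hx, hy]; split_ifs <;> simp
  zero_mem' := fun j => by simp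
  smul_mem' := fun c x hx j => by rw [map_smul, hx]; split_ifs <;> simp

lemma creation_eq_zero_of_mem {S : Finset (Idx n)} {x : Ext n} (hx : x ∈ occSpace S) {j : Idx n}
    (hj : j ∈ S) : creation j x = 0 := by
  have := hx j
  rw [if_pos hj] at this
  rw [← this, creation_numOp_self]

lemma annihilation_eq_zero_of_notMem {S : Finset (Idx n)} {x : Ext n} (hx : x ∈ occSpace S)
    {j : Idx n} (hj : j ∉ S) : annihilation j x = 0 := by
  have := hx j
  rw [if_neg hj] at this
  rw [← annihilation_numOp_self, this, map_zero]

lemma creation_mem_occSpace {S : Finset (Idx n)} {x : Ext n} (hx : x ∈ occSpace S) (j : Idx n) :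
    creation j x ∈ occSpace (insert j S) := by
  intro i
  by_cases h : i = j
  · subst h; simp [numOp_creation_self]
  · rw [numOp_creation_of_ne h, hx i]
    simp only [Finset.mem_insert, h, false_or]
    split_ifs <;> simp

lemma annihilation_mem_occSpace {S : Finset (Idx n)} {x : Ext n} {j : Idx n} (hj : j ∉ S)
    (hx : x ∈ occSpace (insert j S)) : annihilation j x ∈ occSpace S := by
  intro i
  by_cases h : i = j
  · subst h; simp [numOp_annihilation_self, hj]
  · rw [numOp_annihilation_of_ne h, hx i]
    simp only [Finset.mem_insert, h, false_or]
    split_ifs <;> simp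

lemma one_mem_occSpace : (1 : Ext n) ∈ occSpace ∅ := by
  intro j
  rw [numOp_apply, annihilation, contract, CliffordAlgebra.contractLeft_one]
  simp

/-- A joint diagonalization: `1` has nothing occupied, and each creation operator maps one joint
eigenspace into another. -/
lemma iSup_occSpace : ⨆ S : Finset (Idx n), occSpace S = ⊤ := by
  rw [eq_top_iff]
  rintro x -
  induction x using ext_left_induction with
  | one => exact Submodule.mem_iSup_of_mem ∅ one_mem_occSpace
  | add x y hx hy => exact Submodule.add_mem _ hx hy
  | smul c x hx => exact Submodule.smul_mem _ c hx
  | ι_mul x v hx =>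
    rw [ι_mul_eq_sum]
    refine Submodule.sum_mem _ fun j _ => Submodule.smul_mem _ _ ?_
    induction hx using Submodule.iSup_induction' with
    | mem S x hx => exact Submodule.mem_iSup_of_mem _ (creation_mem_occSpace hx j)
    | zero => rw [map_zero]; exact Submodule.zero_mem _
    | add x y _ _ hx hy => rw [map_add]; exact Submodule.add_mem _ hx hy

/-- The eigenvalues of `∑ d_j N_j` are partial sums of the `d_j`. -/
lemma eq_zero_of_weighted_numOp (d : Idx n → ℂ) (c : ℂ) (hc : ∀ S : Finset (Idx n), ∑ j ∈ S, d j ≠ c)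
    {x : Ext n} (hx : ∑ j, d j • numOp j x = c • x) : x = 0 := by
  set T : Module.End ℂ (Ext n) := ∑ j, d j • numOp j with hT
  have hTx : ∀ y, T y = ∑ j, d j • numOp j y := fun y => by simp [hT, LinearMap.sum_apply]
  refine Submodule.disjoint_def.1 (Module.End.eigenspaces_iSupIndep T c) x
    (Module.End.mem_eigenspace_iff.2 (by rw [hTx, hx])) ?_
  -- The operator `T` is the scalar `∑ j ∈ S, d j` on `occSpace S`, so its eigenspaces for
  -- eigenvalues other than `c` already fill the whole algebra.
  have : (⊤ : Submodule ℂ (Ext n)) ≤ ⨆ μ ≠ c, T.eigenspace μ := by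
    rw [← iSup_occSpace]
    refine iSup_le fun S => le_iSup₂_of_le (∑ j ∈ S, d j) (hc S) fun y hy => ?_
    rw [Module.End.mem_eigenspace_iff, hTx, Finset.sum_smul, ← Finset.sum_subset (Finset.subset_univ S)]
    · exact Finset.sum_congr rfl fun j hj => by rw [hy j, if_pos hj]
    · intro j _ hj
      rw [hy j, if_neg hj, smul_zero]
  exact this Submodule.mem_top

/-! ### Degrees under exterior multiplication and contraction. -/

lemma ι_mul_mem_exteriorPower (v : Idx n → ℂ) {k : ℕ} {x : Ext n}
    (hx : x ∈ ⋀[ℂ]^k (Idx n → ℂ)) :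
    ExteriorAlgebra.ι ℂ v * x ∈ ⋀[ℂ]^(k + 1) (Idx n → ℂ) := by
  rw [ExteriorAlgebra.exteriorPower, pow_succ']
  exact Submodule.mul_mem_mul ⟨v, rfl⟩ hx

lemma contract_zero_exteriorPower (φ : Module.Dual ℂ (Idx n → ℂ)) {x : Ext n}
    (hx : x ∈ ⋀[ℂ]^0 (Idx n → ℂ)) : contract φ x = 0 := by
  rw [ExteriorAlgebra.exteriorPower, pow_zero, Submodule.mem_one] at hx
  obtain ⟨c, rfl⟩ := hx
  rw [Algebra.algebraMap_eq_smul_one, map_smul, contract, CliffordAlgebra.contractLeft_one,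
    smul_zero]

lemma exteriorPower_succ_induction {k : ℕ} {P : Ext n → Prop} (add : ∀ x y, P x → P y → P (x + y))
    (ι_mul : ∀ v, ∀ x ∈ ⋀[ℂ]^k (Idx n → ℂ), P (ExteriorAlgebra.ι ℂ v * x)) {x : Ext n}
    (hx : x ∈ ⋀[ℂ]^(k + 1) (Idx n → ℂ)) : P x := by
  rw [ExteriorAlgebra.exteriorPower, pow_succ'] at hx
  induction hx using Submodule.mul_induction_on' with
  | mem_mul_mem a ha b hb =>
    obtain ⟨v, rfl⟩ := ha
    exact ι_mul v b hb
  | add a _ b _ ha hb => exact add _ _ ha hb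

lemma contract_mem_exteriorPower (φ : Module.Dual ℂ (Idx n → ℂ)) {k : ℕ} {x : Ext n}
    (hx : x ∈ ⋀[ℂ]^(k + 1) (Idx n → ℂ)) : contract φ x ∈ ⋀[ℂ]^k (Idx n → ℂ) := by
  induction k generalizing x with
  | zero =>
    refine exteriorPower_succ_induction (P := fun x => contract φ x ∈ _) (fun x y hx hy => ?_)
      (fun v x hx => ?_) hx
    · rw [map_add]; exact Submodule.add_mem _ hx hy
    · rw [contract_ι_mul, contract_zero_exteriorPower φ hx, mul_zero, sub_zero]
      exact Submodule.smul_mem _ _ hx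
  | succ k ih =>
    refine exteriorPower_succ_induction (P := fun x => contract φ x ∈ _) (fun x y hx hy => ?_)
      (fun v x hx => ?_) hx
    · rw [map_add]; exact Submodule.add_mem _ hx hy
    · rw [contract_ι_mul]
      exact Submodule.sub_mem _ (Submodule.smul_mem _ _ hx) (ι_mul_mem_exteriorPower v (ih hx))

/-- The total number operator is multiplication by the degree. -/
lemma sum_numOp {k : ℕ} {x : Ext n} (hx : x ∈ ⋀[ℂ]^k (Idx n → ℂ)) :
    ∑ j, numOp j x = (k : ℂ) • x := by
  induction k generalizing x with
  | zero =>
    simp only [numOp_apply, annihilation, contract_zero_exteriorPower _ hx]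
    simp
  | succ k ih =>
    refine exteriorPower_succ_induction (P := fun x => ∑ j, numOp j x = ((k + 1 : ℕ) : ℂ) • x)
      (fun x y hx hy => ?_) (fun v x hx => ?_) hx
    · simp only [map_add, Finset.sum_add_distrib, hx, hy, smul_add]
    · have h : ∀ j, numOp j (ExteriorAlgebra.ι ℂ v * x) =
          v j • creation j x + ExteriorAlgebra.ι ℂ v * numOp j x := by
        intro j
        rw [numOp_apply, annihilation, contract_ι_mul, map_sub, map_smul, creation_apply,
          creation_apply, ι_mul_ι_swap, sub_neg_eq_add, LinearMap.proj_apply]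
        rfl
      simp only [h, Finset.sum_add_distrib, ← Finset.mul_sum, ih hx, ← ι_mul_eq_sum,
        mul_smul_comm]
      push_cast
      module

lemma creation_mem_exteriorPower (j : Idx n) {k : ℕ} {x : Ext n}
    (hx : x ∈ ⋀[ℂ]^k (Idx n → ℂ)) : creation j x ∈ ⋀[ℂ]^(k + 1) (Idx n → ℂ) :=
  ι_mul_mem_exteriorPower _ hx

lemma annihilation_mem_exteriorPower (j : Idx n) {k : ℕ} {x : Ext n}
    (hx : x ∈ ⋀[ℂ]^(k + 1) (Idx n → ℂ)) : annihilation j x ∈ ⋀[ℂ]^k (Idx n → ℂ) :=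
  contract_mem_exteriorPower _ hx

lemma numOp_mem_exteriorPower (j : Idx n) {k : ℕ} {x : Ext n}
    (hx : x ∈ ⋀[ℂ]^k (Idx n → ℂ)) : numOp j x ∈ ⋀[ℂ]^k (Idx n → ℂ) := by
  cases k with
  | zero =>
    rw [numOp_apply, annihilation, contract_zero_exteriorPower _ hx, map_zero]
    exact Submodule.zero_mem _
  | succ k => exact creation_mem_exteriorPower j (annihilation_mem_exteriorPower j hx)

/-! ### The transposition form -/

/-- The dot product with `v` as a functional. -/
def dotFun (v : Idx n → ℂ) : Module.Dual ℂ (Idx n → ℂ) := ∑ j, v j • coordFun j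

lemma dotFun_apply (v w : Idx n → ℂ) : dotFun v w = v ⬝ᵥ w := by
  simp [dotFun, dotProduct, LinearMap.sum_apply]

lemma dotFun_add (v w : Idx n → ℂ) : dotFun (v + w) = dotFun v + dotFun w := by
  ext; simp [dotFun_apply]

lemma dotFun_smul (c : ℂ) (v : Idx n → ℂ) : dotFun (c • v) = c • dotFun v := by
  ext; simp [dotFun_apply]

/-- The anti-homomorphism from the exterior algebra to its endomorphisms sending `v` to the
contraction with the functional `v ⬝ᵥ _`. -/
def contractAlong : Ext n →ₐ[ℂ] (Module.End ℂ (Ext n))ᵐᵒᵖ :=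
  ExteriorAlgebra.lift ℂ
    ⟨({ toFun := fun v => MulOpposite.op (contract (dotFun v))
        map_add' := fun v w => by
          rw [← MulOpposite.op_add]
          congr 1
          ext1 x
          rw [dotFun_add, contract, map_add]
        map_smul' := fun c v => by
          rw [RingHom.id_apply, ← MulOpposite.op_smul]
          congr 1
          ext1 x
          rw [dotFun_smul, contract, map_smul] } :
        (Idx n → ℂ) →ₗ[ℂ] (Module.End ℂ (Ext n))ᵐᵒᵖ), fun v => by
      apply MulOpposite.unop_injective
      exact LinearMap.ext (CliffordAlgebra.contractLeft_contractLeft (Q := 0) (dotFun v))⟩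

/-- The symmetric bilinear form for which the products of distinct basis vectors
are orthonormal up to sign. -/
def form (x y : Ext n) : ℂ :=
  ExteriorAlgebra.algebraMapInv (MulOpposite.unop (contractAlong x) y)

lemma form_add_left (x y z : Ext n) : form (x + y) z = form x z + form y z := by
  simp [form]

lemma form_add_right (x y z : Ext n) : form x (y + z) = form x y + form x z := by
  simp [form]

lemma form_smul_left (c : ℂ) (x y : Ext n) : form (c • x) y = c * form x y := by
  simp [form]

lemma form_smul_right (c : ℂ) (x y : Ext n) : form x (c • y) = c * form x y := by
  simp [form]

lemma form_sub_left (x y z : Ext n) : form (x - y) z = form x z - form y z := by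
  simp [form]

lemma form_sub_right (x y z : Ext n) : form x (y - z) = form x y - form x z := by
  simp [form]

lemma form_one_one : form (1 : Ext n) 1 = 1 := by
  simp [form]

lemma form_ι_mul (v : Idx n → ℂ) (x y : Ext n) :
    form (ExteriorAlgebra.ι ℂ v * x) y = form x (contract (dotFun v) y) := by
  simp only [form, map_mul, MulOpposite.unop_mul]
  rw [contractAlong, ExteriorAlgebra.lift_ι_apply]
  rfl

/-- The form as a bilinear map. -/
def formMap : Ext n →ₗ[ℂ] Ext n →ₗ[ℂ] ℂ :=
  LinearMap.mk₂ ℂ form form_add_left form_smul_left form_add_right form_smul_right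

lemma formMap_apply (x y : Ext n) : formMap x y = form x y := rfl

lemma form_creation (j : Idx n) (x y : Ext n) :
    form (creation j x) y = form x (annihilation j y) := by
  rw [creation_apply, form_ι_mul, annihilation]
  congr 3
  ext i
  simp [dotFun_apply, Pi.single_apply, eq_comm]

/-- The other half of the adjointness of creation and annihilation. It is obtained by induction
rather than from symmetry of the form: both sides satisfy the same recursion, because contractions
are antiderivations. -/
lemma form_annihilation (j : Idx n) (x y : Ext n) :
    form (annihilation j x) y = form x (creation j y) := by
  induction x using ext_left_induction generalizing y with
  | one =>
    rw [annihilation, contract, CliffordAlgebra.contractLeft_one, creation_apply]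
    simp [form, ExteriorAlgebra.algebraMapInv]
  | add x x' hx hx' => rw [map_add, form_add_left, form_add_left, hx, hx']
  | smul c x hx => rw [map_smul, form_smul_left, form_smul_left, hx]
  | ι_mul x v hx =>
    rw [form_ι_mul, annihilation, contract_ι_mul, form_sub_left, form_smul_left, form_ι_mul]
    change _ - form (annihilation j x) _ = _
    rw [hx, creation_apply, creation_apply, contract_ι_mul, form_sub_right, form_smul_right,
      dotFun_apply]
    simp

lemma extAct_eq_sum (A : Matrix (Idx n) (Idx n) ℂ) (x : Ext n) :
    extAct A x = ∑ i, ∑ j, A i j • creation i (annihilation j x) := by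
  rw [Finset.sum_comm]
  simp only [extAct, LinearMap.sum_apply, LinearMap.comp_apply, LinearMap.mulLeft_apply,
    ι_mul_eq_sum]
  refine Finset.sum_congr rfl fun j _ => Finset.sum_congr rfl fun i _ => ?_
  simp
  rfl

/-- The adjoint of `creation i * annihilation j` is `creation j * annihilation i`, so transposition
of matrices is adjunction for the form. -/
lemma form_extAct (A : Matrix (Idx n) (Idx n) ℂ) (x y : Ext n) :
    form (extAct A x) y = form x (extAct Aᵀ y) := by
  rw [← formMap_apply, ← formMap_apply, extAct_eq_sum, extAct_eq_sum, Finset.sum_comm]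
  simp only [map_sum, LinearMap.sum_apply, map_smul, LinearMap.smul_apply, formMap_apply,
    form_creation, form_annihilation, Matrix.transpose_apply]

/-- For every set `S` of basis vectors there is a normalized vector of degree `|S|` in which
exactly the elements of `S` are occupied. -/
lemma exists_mem_occSpace (S : Finset (Idx n)) :
    ∃ w ∈ occSpace S, w ∈ ⋀[ℂ]^S.card (Idx n → ℂ) ∧ form w w = 1 ∧
      ∀ y ∈ occSpace S, y ∈ ⋀[ℂ]^S.card (Idx n → ℂ) → ∃ c : ℂ, y = c • w := by
  induction S using Finset.induction_on with
  | empty =>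
    refine ⟨1, one_mem_occSpace, ?_, form_one_one, fun y _ hy => ?_⟩
    · rw [ExteriorAlgebra.exteriorPower, Finset.card_empty, pow_zero]
      exact Submodule.one_le.1 le_rfl
    · rw [ExteriorAlgebra.exteriorPower, Finset.card_empty, pow_zero, Submodule.mem_one] at hy
      obtain ⟨c, rfl⟩ := hy
      exact ⟨c, Algebra.algebraMap_eq_smul_one c⟩
  | insert j S hj ih =>
    obtain ⟨w, hw, hwk, hww, huniq⟩ := ih
    rw [Finset.card_insert_of_notMem hj]
    refine ⟨creation j w, creation_mem_occSpace hw j, creation_mem_exteriorPower j hwk, ?_,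
      fun y hy hyk => ?_⟩
    · rw [form_creation, annihilation_creation_self, hw j, if_neg hj, sub_zero, hww]
    · obtain ⟨c, hc⟩ := huniq _ (annihilation_mem_occSpace hj hy)
        (annihilation_mem_exteriorPower j hyk)
      refine ⟨c, ?_⟩
      have := hy j
      rw [if_pos (Finset.mem_insert_self _ _), numOp_apply, hc, map_smul] at this
      exact this.symm

end Fock

/-! ### Irreducibility of the kernels of the contraction maps -/

section Irreducible

variable {n : ℕ}

lemma sp_lie_ext (A : Sp n) (x : Ext n) :
    ⁅A, x⁆ = extAct (A : Matrix (Idx n) (Idx n) ℂ) x := rfl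

lemma extAct_single (p q : Idx n) (x : Ext n) :
    extAct (Matrix.single p q 1) x = creation p (annihilation q x) := by
  rw [extAct_eq_sum, Finset.sum_eq_single p, Finset.sum_eq_single q]
  · simp
  · intro j _ hj; simp [hj.symm]
  · simp
  · intro i _ hi
    exact Finset.sum_eq_zero fun j _ => by simp [hi.symm]
  · simp

lemma extAct_add (A B : Matrix (Idx n) (Idx n) ℂ) (x : Ext n) :
    extAct (A + B) x = extAct A x + extAct B x := add_lie A B x

lemma extAct_sub (A B : Matrix (Idx n) (Idx n) ℂ) (x : Ext n) :
    extAct (A - B) x = extAct A x - extAct B x := sub_lie A B x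

lemma xPlus_coe (i j : Fin n) : (xPlus i j : Matrix (Idx n) (Idx n) ℂ) =
    Matrix.single (Sum.inl i) (Sum.inr j) 1 + Matrix.single (Sum.inl j) (Sum.inr i) 1 := by
  ext (p | p) (q | q) <;> simp [xPlus, Matrix.single_apply]

lemma xMinus_coe (i j : Fin n) : (xMinus i j : Matrix (Idx n) (Idx n) ℂ) =
    Matrix.single (Sum.inl i) (Sum.inl j) 1 - Matrix.single (Sum.inr j) (Sum.inr i) 1 := by
  ext (p | p) (q | q) <;> simp [xMinus, Matrix.single_apply]

/-- `X_{-ε_k - ε_l} = e_{n+k,l} + e_{n+l,k}`. -/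
def xLow (k l : Fin n) : Sp n :=
  ⟨Matrix.fromBlocks 0 0 (Matrix.single k l 1 + Matrix.single l k 1) (-0ᵀ),
    fromBlocks_mem _ _ _ (by simp) (by simp [add_comm])⟩

lemma xPlus_lie_ext (i j : Fin n) (x : Ext n) : ⁅xPlus i j, x⁆ =
    creation (Sum.inl i) (annihilation (Sum.inr j) x) +
      creation (Sum.inl j) (annihilation (Sum.inr i) x) := by
  rw [sp_lie_ext, xPlus_coe, extAct_add, extAct_single, extAct_single]

lemma xMinus_lie_ext (i j : Fin n) (x : Ext n) : ⁅xMinus i j, x⁆ =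
    creation (Sum.inl i) (annihilation (Sum.inl j) x) -
      creation (Sum.inr j) (annihilation (Sum.inr i) x) := by
  rw [sp_lie_ext, xMinus_coe, extAct_sub, extAct_single, extAct_single]

lemma hElt_eq_xMinus (i : Fin n) : hElt i = xMinus i i := rfl

lemma hElt_lie_ext (i : Fin n) (x : Ext n) : ⁅hElt i, x⁆ =
    numOp (Sum.inl i) x - numOp (Sum.inr i) x := xMinus_lie_ext i i x

lemma theta_apply (x : Ext n) :
    theta n x = ∑ i, annihilation (Sum.inr i) (annihilation (Sum.inl i) x) := by
  simp [theta, LinearMap.sum_apply, annihilation]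

/-- A primitive element of degree at most `n` killed by the `X_{ε_i + ε_j}` does not involve the
last `n` basis vectors. -/
lemma annihilation_inr_eq_zero {k : ℕ} (hk : k ≤ n) {x : Ext n} (hx : x ∈ ⋀[ℂ]^k (Idx n → ℂ))
    (hθ : theta n x = 0) (hP : ∀ i j : Fin n, ⁅xPlus i j, x⁆ = 0) (j : Fin n) :
    annihilation (Sum.inr j) x = 0 := by
  have hθ' : ∑ i, annihilation (Sum.inl i) (annihilation (Sum.inr i) x) = 0 := by
    rw [theta_apply] at hθ
    rw [← neg_eq_zero, ← Finset.sum_neg_distrib, ← hθ]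
    exact Finset.sum_congr rfl fun i _ => (annihilation_annihilation _ _ _).symm
  -- Write `a_i`, `b_i` for the annihilation operators of `inl i`, `inr i`, with adjoints `a_i†`,
  -- `b_i†`. The relation `(a_i† b_j + a_j† b_i) x = 0` is multiplied by `b_j† a_i` and reordered so
  -- that `∑ a_i b_i`, which is `-θ`, appears on the right.
  have h1 : ∀ i : Fin n, (numOp (Sum.inr j) x - numOp (Sum.inr j) (numOp (Sum.inl i) x)) +
      ((if i = j then numOp (Sum.inr j) x else 0) - creation (Sum.inr j) (creation (Sum.inl j)
        (annihilation (Sum.inl i) (annihilation (Sum.inr i) x)))) = 0 := by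
    intro i
    have := congrArg (fun y => creation (Sum.inr j) (annihilation (Sum.inl i) y))
      ((xPlus_lie_ext i j x).symm.trans (hP i j))
    simp only [map_zero, map_add] at this
    rw [annihilation_creation_self, annihilation_creation, numOp_annihilation_of_ne (by simp),
      map_sub, map_sub] at this
    refine Eq.trans ?_ this
    by_cases h : i = j
    · simp [h, numOp_apply]
    · simp [h, numOp_apply]
  have h2 := Finset.sum_eq_zero (s := Finset.univ) fun i _ => h1 i
  have hz : ∑ i, creation (Sum.inr j) (creation (Sum.inl j)
      (annihilation (Sum.inl i) (annihilation (Sum.inr i) x))) = 0 := by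
    rw [← map_sum, ← map_sum, hθ', map_zero, map_zero]
  rw [Finset.sum_add_distrib, Finset.sum_sub_distrib, Finset.sum_sub_distrib, hz,
    Finset.sum_const, ← map_sum, Finset.sum_ite_eq' Finset.univ j, if_pos (Finset.mem_univ j),
    Finset.card_univ, Fintype.card_fin, sub_zero] at h2
  -- Summing over `i` and replacing the occupation of the first `n` vectors by `k` minus that of the
  -- last `n` gives `(n + 1 - k + ∑ b_i† b_i) b_j† b_j x = 0`. The first factor has only positive
  -- eigenvalues because `k ≤ n`.
  have h3 := sum_numOp hx
  rw [Fintype.sum_sum_type, ← eq_sub_iff_add_eq] at h3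
  rw [h3, map_sub, map_smul, map_sum] at h2
  have h4 : numOp (Sum.inr j) x = 0 := by
    refine eq_zero_of_weighted_numOp (Sum.elim 0 1) (-((n : ℂ) + 1 - k)) (fun S hS => ?_) ?_
    · have : ∑ p ∈ S, (Sum.elim 0 1 : Idx n → ℂ) p =
          ((∑ p ∈ S, (Sum.elim 0 1 : Idx n → ℕ) p : ℕ) : ℂ) := by
        rw [Nat.cast_sum]
        refine Finset.sum_congr rfl fun p _ => ?_
        rcases p with p | p <;> simp
      rw [this] at hS
      have h5 : (((∑ p ∈ S, (Sum.elim 0 1 : Idx n → ℕ) p) + n + 1 : ℕ) : ℂ) = (k : ℕ) := by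
        push_cast at hS ⊢
        rw [hS]; ring
      have := Nat.cast_injective h5
      omega
    · rw [Fintype.sum_sum_type]
      simp only [Sum.elim_inl, Sum.elim_inr, Pi.zero_apply, Pi.one_apply, zero_smul, one_smul,
        Finset.sum_const_zero, zero_add]
      simp only [numOp_comm (Sum.inr j)] at h2
      rw [← sub_eq_zero, ← h2]
      rw [← Nat.cast_smul_eq_nsmul ℂ]
      module
  rw [← annihilation_numOp_self, h4, map_zero]

lemma numOp_eq_self_of_creation {p : Idx n} {x : Ext n} (h : creation p x = 0) :
    numOp p x = x := by
  have := annihilation_creation_self p x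
  rw [h, map_zero] at this
  exact (sub_eq_zero.1 this.symm).symm

/-- The first `k` basis vectors. -/
def firstIdx (n k : ℕ) : Finset (Idx n) :=
  (Finset.univ.filter fun i : Fin n => i.val < k).map Function.Embedding.inl

lemma inl_mem_firstIdx {k : ℕ} (i : Fin n) : Sum.inl i ∈ firstIdx n k ↔ i.val < k := by
  simp [firstIdx]

lemma inr_notMem_firstIdx {k : ℕ} (i : Fin n) : Sum.inr i ∉ firstIdx n k := by
  simp [firstIdx]

lemma card_firstIdx {k : ℕ} (hk : k ≤ n) : (firstIdx n k).card = k := by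
  rw [firstIdx, Finset.card_map, Fin.card_filter_val_lt, min_eq_right hk]

/-- Counting the occupied vectors among those in `Q` gives a natural number at most the size of `Q`,
so no other eigenvalue `c` is possible. -/
lemma eq_zero_of_sum_inl_numOp (Q : Fin n → Prop) [DecidablePred Q] (c : ℂ)
    (hc : ∀ m : ℕ, m ≤ (Finset.univ.filter Q).card → (m : ℂ) ≠ c) {x : Ext n}
    (hx : ∑ i with Q i, numOp (Sum.inl i) x = c • x) : x = 0 := by
  refine eq_zero_of_weighted_numOp (Sum.elim (fun i => if Q i then 1 else 0) 0) c (fun S hS => ?_) ?_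
  · refine hc (∑ p ∈ S, Sum.elim (fun i => if Q i then 1 else 0) 0 p) ?_ ?_
    · refine (Finset.sum_le_sum_of_subset (Finset.subset_univ S)).trans ?_
      rw [Fintype.sum_sum_type]
      simp
    · rw [← hS, Nat.cast_sum]
      refine Finset.sum_congr rfl fun p _ => ?_
      rcases p with p | p <;> simp
  · rw [Fintype.sum_sum_type, ← hx, Finset.sum_filter]
    simp

/-- An element of degree `k` in the first `n` basis vectors that is killed by the `e_{i,j}`,
`i < j`, involves exactly the first `k` basis vectors. -/
lemma mem_occSpace_firstIdx {k : ℕ} {x : Ext n} (hx : x ∈ ⋀[ℂ]^k (Idx n → ℂ))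
    (hr : ∀ i : Fin n, annihilation (Sum.inr i) x = 0)
    (hl : ∀ i j : Fin n, i < j → creation (Sum.inl i) (annihilation (Sum.inl j) x) = 0) :
    x ∈ occSpace (firstIdx n k) := by
  have hr' : ∀ i : Fin n, numOp (Sum.inr i) x = 0 := fun i => by rw [numOp_apply, hr, map_zero]
  -- Occupation is downward closed: if `j` is occupied, so is every `i < j`.
  have hN : ∀ i j : Fin n, i < j →
      numOp (Sum.inl i) (numOp (Sum.inl j) x) = numOp (Sum.inl j) x := fun i j hij =>
    numOp_eq_self_of_creation <| by
      rw [numOp_apply, creation_creation, hl i j hij, map_zero, neg_zero]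
  have hsum : ∀ y ∈ ⋀[ℂ]^k (Idx n → ℂ), (∀ i : Fin n, numOp (Sum.inr i) y = 0) →
      ∑ i, numOp (Sum.inl i) y = (k : ℂ) • y := fun y hy h => by
    rw [← sum_numOp hy, Fintype.sum_sum_type]
    simp [h]
  rintro (i | i)
  · simp only [inl_mem_firstIdx]
    split_ifs with hi
    · refine (sub_eq_zero.1 ?_).symm
      -- The part of `x` with `i` empty: everything from `i` on is empty, which leaves at most `i <
      -- k` occupied vectors in degree `k`.
      set y := x - numOp (Sum.inl i) x with hy
      have hy0 : ∀ j, i ≤ j → numOp (Sum.inl j) y = 0 := fun j hj => by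
        rw [hy, map_sub]
        rcases hj.eq_or_lt with rfl | hj
        · rw [numOp_numOp_self, sub_self]
        · rw [numOp_comm, hN i j hj, sub_self]
      have h1 := hsum y (Submodule.sub_mem _ hx (numOp_mem_exteriorPower _ hx))
        (fun j => by rw [hy, map_sub, numOp_comm, hr', map_zero, sub_zero])
      refine eq_zero_of_sum_inl_numOp (fun j => j < i) k (fun m hm h => ?_) ?_
      · have := Nat.cast_injective h
        rw [show (Finset.univ.filter fun j => j < i) = Finset.Iio i by ext; simp,
          Fin.card_Iio] at hm
        omega
      · rw [← h1, Finset.sum_filter]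
        refine Finset.sum_congr rfl fun j _ => ?_
        split_ifs with h
        · rfl
        · rw [hy0 j (not_lt.1 h)]
    -- The part of `x` with `i` occupied: all `i + 1 > k` vectors up to `i` are occupied, too many
    -- for degree `k`.
    · set y := numOp (Sum.inl i) x with hy
      have hy0 : ∀ j, j ≤ i → numOp (Sum.inl j) y = y := fun j hj => by
        rcases hj.eq_or_lt with rfl | hj
        · rw [hy, numOp_numOp_self]
        · rw [hy, hN j i hj]
      have h1 := hsum y (numOp_mem_exteriorPower _ hx)
        (fun j => by rw [hy, numOp_comm, hr', map_zero])
      refine eq_zero_of_sum_inl_numOp (fun j => i < j) (k - (i.val + 1)) (fun m hm h => ?_) ?_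
      · have : ((m + i.val + 1 : ℕ) : ℂ) = (k : ℕ) := by push_cast; rw [h]; ring
        have := Nat.cast_injective this
        omega
      · have h2 : ∑ j with ¬ i < j, numOp (Sum.inl j) y = ((i.val : ℂ) + 1) • y := by
          rw [Finset.sum_congr rfl fun j hj => hy0 j (not_lt.1 (Finset.mem_filter.1 hj).2),
            Finset.sum_const, ← Nat.cast_smul_eq_nsmul ℂ]
          congr 1
          rw [show (Finset.univ.filter fun j => ¬ i < j) = Finset.Iic i by ext; simp, Fin.card_Iic]
          push_cast
          rfl
        rw [← Finset.sum_filter_add_sum_filter_not _ (fun j => i < j), h2] at h1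
        rw [sub_smul, ← h1, add_sub_cancel_right]
  · rw [if_neg (inr_notMem_firstIdx i), hr']

/-- In a nonzero finite-dimensional module some nonzero vector is killed by all elements of
positive degree with respect to `h`. -/
lemma exists_killed_of_pos {L M : Type*} [LieRing L] [LieAlgebra ℂ L] [AddCommGroup M] [Module ℂ M]
    [LieRingModule L M] [LieModule ℂ L M] [FiniteDimensional ℂ M] [Nontrivial M] (h : L) :
    ∃ v : M, v ≠ 0 ∧ ∀ (x : L) (m : ℕ), 0 < m → ⁅h, x⁆ = (m : ℂ) • x → ⁅x, v⁆ = 0 := by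
  set T := LieModule.toEnd ℂ L M h with hT
  obtain ⟨μ₀, hμ₀⟩ := Module.End.exists_eigenvalue T
  -- An eigenvalue of maximal real part: an element of positive degree `m` would move its
  -- eigenvector to the eigenvalue `μ + m`.
  obtain ⟨μ, hμ, hmax⟩ := Set.exists_max_image {μ | T.HasEigenvalue μ} Complex.re
    T.finite_hasEigenvalue ⟨μ₀, hμ₀⟩
  obtain ⟨v, hv⟩ := hμ.exists_hasEigenvector
  refine ⟨v, hv.2, fun x m hm hx => ?_⟩
  by_contra hne
  have h1 : ⁅h, v⁆ = μ • v := hv.apply_eq_smul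
  have h2 : T.HasEigenvalue (μ + m) := by
    refine Module.End.hasEigenvalue_of_hasEigenvector (x := ⁅x, v⁆) ⟨?_, hne⟩
    rw [Module.End.mem_eigenspace_iff, hT, LieModule.toEnd_apply_apply, leibniz_lie, hx, h1,
      lie_smul, smul_lie, ← add_smul, add_comm]
  have := hmax _ h2
  simp at this
  omega

/-! ### Root vectors of the symplectic algebra and its grading element. -/

lemma sp_coe_smul (c : ℂ) (X : Sp n) :
    ((c • X : Sp n) : Matrix (Idx n) (Idx n) ℂ) = c • (X : Matrix (Idx n) (Idx n) ℂ) := rfl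

lemma sp_coe_add (X Y : Sp n) :
    ((X + Y : Sp n) : Matrix (Idx n) (Idx n) ℂ) = (X : Matrix (Idx n) (Idx n) ℂ) + Y := rfl

/-- The weights of the basis vectors under the grading element. -/
def gradingWeight (i : Fin n) : ℂ := (n : ℂ) - (i.val : ℂ)

/-- A grading element of `𝔰𝔭_N` with respect to which the positive root vectors have positive
degree. -/
def gradingElt (n : ℕ) : Sp n := ∑ i, gradingWeight i • hElt i

lemma gradingElt_coe : (gradingElt n : Matrix (Idx n) (Idx n) ℂ) =
    Matrix.diagonal (Sum.elim gradingWeight (-gradingWeight)) := by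
  rw [gradingElt, AddSubmonoidClass.coe_finsetSum]
  simp only [sp_coe_smul, hElt_eq_xMinus, xMinus_coe]
  ext (p | p) (q | q) <;> simp [Matrix.sum_apply, Matrix.single_apply, Matrix.diagonal_apply]
  · simp only [ite_and, Finset.sum_ite_eq', Finset.mem_univ, if_true]
  · simp only [ite_and, Finset.sum_ite_eq', Finset.mem_univ, if_true]
    split_ifs <;> simp

/-- The commutator with a diagonal matrix multiplies the entry `(p, q)` by the difference of the
weights of `p` and `q`. -/
lemma gradingElt_lie {X : Sp n} {c : ℂ} (h : ∀ p q, (X : Matrix (Idx n) (Idx n) ℂ) p q ≠ 0 →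
    Sum.elim gradingWeight (-gradingWeight) p - Sum.elim gradingWeight (-gradingWeight) q = c) :
    ⁅gradingElt n, X⁆ = c • X := by
  apply Subtype.ext
  rw [LieSubalgebra.coe_bracket, sp_coe_smul, gradingElt_coe, Ring.lie_def]
  ext p q
  simp only [Matrix.sub_apply, Matrix.diagonal_mul, Matrix.mul_diagonal, Matrix.smul_apply,
    smul_eq_mul]
  by_cases hX : (X : Matrix (Idx n) (Idx n) ℂ) p q = 0
  · simp [hX]
  · rw [← h p q hX]; ring

lemma xLow_coe (i j : Fin n) : (xLow i j : Matrix (Idx n) (Idx n) ℂ) =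
    Matrix.single (Sum.inr i) (Sum.inl j) 1 + Matrix.single (Sum.inr j) (Sum.inl i) 1 := by
  ext (p | p) (q | q) <;> simp [xLow, Matrix.single_apply]

lemma gradingElt_lie_xMinus (i j : Fin n) :
    ⁅gradingElt n, xMinus i j⁆ = ((j.val : ℂ) - i.val) • xMinus i j := by
  apply gradingElt_lie
  rintro (p | p) (q | q) <;> simp [xMinus_coe, Matrix.single_apply, gradingWeight] <;>
    · rintro rfl rfl; ring

lemma gradingElt_lie_xPlus (i j : Fin n) :
    ⁅gradingElt n, xPlus i j⁆ = (((n - i.val) + (n - j.val) : ℕ) : ℂ) • xPlus i j := by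
  apply gradingElt_lie
  have hi := i.2.le
  have hj := j.2.le
  push_cast [hi, hj]
  rintro (p | p) (q | q) <;> simp [xPlus_coe, Matrix.single_apply, gradingWeight]
  intro h
  by_contra h'
  apply h
  rw [if_neg, if_neg, add_zero] <;>
  · rintro ⟨rfl, rfl⟩; exact h' (by ring)

lemma gradingElt_lie_xLow (i j : Fin n) :
    ⁅gradingElt n, xLow i j⁆ = (-(((n - i.val) + (n - j.val) : ℕ) : ℂ)) • xLow i j := by
  apply gradingElt_lie
  have hi := i.2.le
  have hj := j.2.le
  push_cast [hi, hj]
  rintro (p | p) (q | q) <;> simp [xLow_coe, Matrix.single_apply, gradingWeight]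
  intro h
  by_contra h'
  apply h
  rw [if_neg, if_neg, add_zero] <;>
  · rintro ⟨rfl, rfl⟩; exact h' (by ring)

lemma sp_entries (X : Sp n) (i j : Fin n) :
    (X : Matrix (Idx n) (Idx n) ℂ) (Sum.inr i) (Sum.inr j) =
      -(X : Matrix (Idx n) (Idx n) ℂ) (Sum.inl j) (Sum.inl i) ∧
    (X : Matrix (Idx n) (Idx n) ℂ) (Sum.inl i) (Sum.inr j) =
      (X : Matrix (Idx n) (Idx n) ℂ) (Sum.inl j) (Sum.inr i) ∧
    (X : Matrix (Idx n) (Idx n) ℂ) (Sum.inr i) (Sum.inl j) =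
      (X : Matrix (Idx n) (Idx n) ℂ) (Sum.inr j) (Sum.inl i) := by
  have hA : (X : Matrix (Idx n) (Idx n) ℂ)ᵀ * Matrix.J (Fin n) ℂ = Matrix.J (Fin n) ℂ * -X := by
    have := X.2
    change _ ∈ skewAdjointMatricesLieSubalgebra _ at this
    rw [mem_skewAdjointMatricesLieSubalgebra, mem_skewAdjointMatricesSubmodule] at this
    exact this
  have h1 := congrFun (congrFun hA (Sum.inl i)) (Sum.inl j)
  have h2 := congrFun (congrFun hA (Sum.inl i)) (Sum.inr j)
  have h3 := congrFun (congrFun hA (Sum.inr i)) (Sum.inr j)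
  simp [Matrix.mul_apply, Matrix.J, Fintype.sum_sum_type, Matrix.one_apply, Matrix.neg_apply] at h1 h2 h3
  exact ⟨h2.symm, by rw [h3], by rw [h1]⟩

/-- The halves compensate for the sum over ordered pairs: `xPlus` and `xLow` are symmetric in their
indices, and for `i = j` they carry the entry `2`. -/
lemma sp_eq_sum (X : Sp n) : X =
    ∑ i, ∑ j, ((X : Matrix (Idx n) (Idx n) ℂ) (Sum.inl i) (Sum.inl j) • xMinus i j +
      ((X : Matrix (Idx n) (Idx n) ℂ) (Sum.inl i) (Sum.inr j) / 2) • xPlus i j +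
      ((X : Matrix (Idx n) (Idx n) ℂ) (Sum.inr i) (Sum.inl j) / 2) • xLow i j) := by
  apply Subtype.ext
  simp only [AddSubmonoidClass.coe_finsetSum, sp_coe_add, sp_coe_smul,
    xMinus_coe, xPlus_coe, xLow_coe]
  ext (p | p) (q | q)
  all_goals simp [Matrix.sum_apply, Matrix.single_apply, Finset.sum_add_distrib, ite_and]
  · rw [(sp_entries X q p).2.1]; ring
  · rw [(sp_entries X q p).2.2]; ring
  · exact (sp_entries X p q).1

lemma sp_transpose_mem (X : Sp n) : (X : Matrix (Idx n) (Idx n) ℂ)ᵀ ∈ Sp n := by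
  have h := sp_entries X
  have := fromBlocks_mem (n := n) (X : Matrix (Idx n) (Idx n) ℂ)ᵀ.toBlocks₁₁
    (X : Matrix (Idx n) (Idx n) ℂ)ᵀ.toBlocks₁₂ (X : Matrix (Idx n) (Idx n) ℂ)ᵀ.toBlocks₂₁
    (by ext i j; exact (h i j).2.2) (by ext i j; exact (h i j).2.1)
  convert this using 1
  ext (p | p) (q | q)
  · rfl
  · rfl
  · rfl
  · exact (h q p).1

lemma kerTheta_coe_lie {k : ℕ} (A : Sp n) (x : kerTheta n k) :
    ((⁅A, x⁆ : kerTheta n k) : Ext n) = ⁅A, (x : Ext n)⁆ := rfl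

instance {k : ℕ} : FiniteDimensional ℂ (kerTheta n k) :=
  Submodule.finiteDimensional_of_le (S₂ := ⋀[ℂ]^k (Idx n → ℂ)) inf_le_left

/-- The highest weight vector of `Ker θ_k`. -/
lemma exists_highest_kerTheta {k : ℕ} (hk : k ≤ n) :
    ∃ w : kerTheta n k, (w : Ext n) ∈ occSpace (firstIdx n k) ∧ form (w : Ext n) w = 1 ∧
      ∀ x : kerTheta n k, (∀ i j : Fin n, i < j → ⁅xMinus i j, x⁆ = 0) → (∀ i j : Fin n, ⁅xPlus i j, x⁆ = 0) →
        ∃ c : ℂ, x = c • w := by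
  obtain ⟨w, hw, hwk, hww, huniq⟩ := exists_mem_occSpace (firstIdx n k)
  rw [card_firstIdx hk] at hwk huniq
  refine ⟨⟨w, hwk, ?_⟩, hw, hww, fun x hx1 hx2 => ?_⟩
  · change theta n w = 0
    rw [theta_apply]
    refine Finset.sum_eq_zero fun i _ => ?_
    rw [annihilation_annihilation, annihilation_eq_zero_of_notMem hw (inr_notMem_firstIdx i),
      map_zero, neg_zero]
  · have hxk := x.2.1
    have h0 := annihilation_inr_eq_zero hk hxk x.2.2 fun i j => by
      rw [← kerTheta_coe_lie, hx2]; rfl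
    obtain ⟨c, hc⟩ := huniq x (mem_occSpace_firstIdx hxk h0 fun i j hij => by
      have := xMinus_lie_ext i j (x : Ext n)
      rw [← kerTheta_coe_lie, hx1 i j hij, h0, map_zero, sub_zero] at this
      rw [← this]; rfl) hxk
    exact ⟨c, Subtype.ext hc⟩

/-- A nonzero submodule contains a nonzero vector killed by all elements of positive degree for the
grading element, and by hypothesis that vector is a multiple of `w`. -/
lemma mem_of_ne_bot {k : ℕ} {w : kerTheta n k}
    (hw : ∀ x : kerTheta n k, (∀ i j : Fin n, i < j → ⁅xMinus i j, x⁆ = 0) → (∀ i j : Fin n, ⁅xPlus i j, x⁆ = 0) →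
        ∃ c : ℂ, x = c • w) {M : LieSubmodule ℂ (Sp n) (kerTheta n k)} (hM : M ≠ ⊥) : w ∈ M := by
  have : Nontrivial M := (LieSubmodule.nontrivial_iff_ne_bot ℂ (Sp n) _).2 hM
  obtain ⟨v, hv, h⟩ := exists_killed_of_pos (M := M) (gradingElt n)
  have h1 : ∀ i j : Fin n, i < j → ⁅xMinus i j, (v : kerTheta n k)⁆ = 0 := fun i j hij =>
    congrArg Subtype.val (h (xMinus i j) (j - i) (by omega) (by
      rw [gradingElt_lie_xMinus, Nat.cast_sub (by omega)]))
  have h2 : ∀ i j : Fin n, ⁅xPlus i j, (v : kerTheta n k)⁆ = 0 := fun i j =>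
    congrArg Subtype.val (h (xPlus i j) _ (by omega) (gradingElt_lie_xPlus i j))
  obtain ⟨c, hc⟩ := hw v h1 h2
  have hc0 : c ≠ 0 := by
    rintro rfl
    rw [zero_smul] at hc
    exact hv (Subtype.ext hc)
  have := M.smul_mem c⁻¹ v.2
  rwa [hc, smul_smul, inv_mul_cancel₀ hc0, one_smul] at this

/-- The orthogonal complement of a submodule with respect to the transposition form. -/
def orthogonal {k : ℕ} (M : LieSubmodule ℂ (Sp n) (kerTheta n k)) :
    LieSubmodule ℂ (Sp n) (kerTheta n k) where
  carrier := {y | ∀ x ∈ M, form (x : Ext n) y = 0}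
  add_mem' := fun {a b} ha hb x hx => by
    change form (x : Ext n) (a + b) = 0
    rw [form_add_right, ha x hx, hb x hx, add_zero]
  zero_mem' := fun x _ => by
    change formMap (x : Ext n) 0 = 0
    rw [map_zero]
  smul_mem' := fun c a ha x hx => by
    change form (x : Ext n) (c • a) = 0
    rw [form_smul_right, ha x hx, mul_zero]
  lie_mem := fun {A a} ha x hx => by
    -- Stability under `A` uses that `M` is stable under `Aᵗ`, which again lies in `𝔰𝔭_N`.
    have h1 := ha _ (M.lie_mem (x := ⟨_, sp_transpose_mem A⟩) hx)
    rw [kerTheta_coe_lie, sp_lie_ext, form_extAct, Matrix.transpose_transpose] at h1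
    exact h1

lemma mem_orthogonal {k : ℕ} {M : LieSubmodule ℂ (Sp n) (kerTheta n k)} {y : kerTheta n k} :
    y ∈ orthogonal M ↔ ∀ x ∈ M, form (x : Ext n) y = 0 := Iff.rfl

/-- `Ker θ_k` is irreducible. -/
theorem kerTheta_isIrreducible {k : ℕ} (hk : k ≤ n) :
    LieModule.IsIrreducible ℂ (Sp n) (kerTheta n k) := by
  obtain ⟨w, -, hww, hw⟩ := exists_highest_kerTheta hk
  have hw0 : w ≠ 0 := by
    rintro rfl
    have : formMap (0 : Ext n) 0 = 1 := hww
    simp at this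
  have : Nontrivial (kerTheta n k) := ⟨w, 0, hw0⟩
  have hperp : ∀ M : LieSubmodule ℂ (Sp n) (kerTheta n k), w ∈ M → orthogonal M = ⊥ := by
    intro M hM
    by_contra hne
    have := mem_orthogonal.1 (mem_of_ne_bot hw hne) w hM
    rw [hww] at this
    exact one_ne_zero this
  refine LieModule.IsIrreducible.mk fun N hN => ?_
  by_contra hNtop
  let F : kerTheta n k →ₗ[ℂ] Module.Dual ℂ (kerTheta n k) :=
    (formMap.flip.domRestrict₁₂ (kerTheta n k).toSubmodule (kerTheta n k).toSubmodule)
  have hF : ∀ x y, F y x = form (x : Ext n) y := fun x y => rfl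
  have hinj : Function.Injective F := by
    rw [injective_iff_map_eq_zero]
    intro y hy
    have : y ∈ orthogonal (⊤ : LieSubmodule ℂ (Sp n) (kerTheta n k)) := mem_orthogonal.2 fun x _ => by
      rw [← hF, hy]; rfl
    rw [hperp ⊤ (LieSubmodule.mem_top w)] at this
    exact (LieSubmodule.mem_bot y).1 this
  -- The form is nondegenerate on `Ker θ_k`, so the nonzero functional vanishing on a proper `N` is
  -- the pairing with some `y`; this `y` lies in the orthogonal complement of `N`, which is zero.
  have hsurj : Function.Surjective F :=
    (LinearMap.injective_iff_surjective_of_finrank_eq_finrank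
      (Subspace.dual_finrank_eq (K := ℂ)).symm).1 hinj
  obtain ⟨f, hf, hNf⟩ := Submodule.exists_le_ker_of_lt_top N.toSubmodule
    (lt_top_iff_ne_top.2 fun h => hNtop (by
      rwa [← LieSubmodule.toSubmodule_inj, LieSubmodule.top_toSubmodule]))
  obtain ⟨y, rfl⟩ := hsurj f
  have hy : y ∈ orthogonal N := mem_orthogonal.2 fun x hx => hNf hx
  rw [hperp N (mem_of_ne_bot hw hN), LieSubmodule.mem_bot] at hy
  rw [hy, map_zero] at hf
  exact hf rfl

end Irreducible

/-! ### Identification of the fundamental modules -/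

section Fundamental

variable {n : ℕ}

/-- Replacing `e_j` by `e_i` with `i < j` gives zero: either `j` is empty, or `i` is already
occupied. -/
lemma xMinus_lie_of_mem_occSpace {k : ℕ} {w : Ext n} (hw : w ∈ occSpace (firstIdx n k)) {i j : Fin n}
    (hij : i < j) : ⁅xMinus i j, w⁆ = 0 := by
  rw [xMinus_lie_ext, annihilation_eq_zero_of_notMem hw (inr_notMem_firstIdx i), map_zero, sub_zero]
  by_cases hj : j.val < k
  · have hi : i.val < k := lt_trans hij hj
    rw [← neg_eq_zero, ← annihilation_creation_of_ne (by simpa using hij.ne'),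
      creation_eq_zero_of_mem hw ((inl_mem_firstIdx i).2 hi), map_zero]
  · rw [annihilation_eq_zero_of_notMem hw (mt (inl_mem_firstIdx j).1 hj), map_zero]

lemma xPlus_lie_of_mem_occSpace {k : ℕ} {w : Ext n} (hw : w ∈ occSpace (firstIdx n k))
    (i j : Fin n) : ⁅xPlus i j, w⁆ = 0 := by
  rw [xPlus_lie_ext, annihilation_eq_zero_of_notMem hw (inr_notMem_firstIdx i),
    annihilation_eq_zero_of_notMem hw (inr_notMem_firstIdx j), map_zero, map_zero, add_zero]

lemma hElt_lie_of_mem_occSpace {k : ℕ} {w : Ext n} (hw : w ∈ occSpace (firstIdx n k))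
    (i : Fin n) : ⁅hElt i, w⁆ = (if i.val < k then (1 : ℂ) else 0) • w := by
  rw [hElt_lie_ext, hw, hw, if_neg (inr_notMem_firstIdx i), sub_zero]
  simp only [inl_mem_firstIdx]
  split_ifs <;> simp

/-- The weight is recovered from its values on the simple coroots by descending from `h_n = α_n^∨`
through `h_i = α_i^∨ + h_{i+1}`. -/
lemma hElt_lie_of_coroot {k : ℕ} (hkn : k ≤ n) {V : Type*} [AddCommGroup V] [Module ℂ V]
    [LieRingModule (Sp n) V] [LieModule ℂ (Sp n) V] {v : V}
    (hv : ∀ j : Fin n, ⁅coroot j, v⁆ = (if j.val + 1 = k then (1 : ℂ) else 0) • v) (i : Fin n) :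
    ⁅hElt i, v⁆ = (if i.val < k then (1 : ℂ) else 0) • v := by
  obtain ⟨d, hd⟩ : ∃ d, i.val + 1 + d = n := ⟨n - (i.val + 1), by omega⟩
  induction d generalizing i with
  | zero =>
    have := hv i
    rw [coroot, dif_neg (by omega)] at this
    rw [this]
    congr 2
    rw [eq_iff_iff]; omega
  | succ d ih =>
    have h1 := hv i
    rw [coroot, dif_pos (by omega), sub_lie, sub_eq_iff_eq_add,
      ih ⟨i.val + 1, by omega⟩ (by change i.val + 1 + 1 + d = n; omega)] at h1
    rw [h1, ← add_smul]
    congr 1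
    by_cases h2 : i.val + 1 = k
    · rw [if_pos h2, if_neg (by simp [h2]), if_pos (by omega), add_zero]
    · rw [if_neg h2, zero_add]
      congr 1
      rw [eq_iff_iff]; change i.val + 1 < k ↔ _; omega

/-- The fundamental modules are the kernels of the contraction maps. -/
theorem nonempty_kerTheta_equiv {k : ℕ} (hkn : k ≤ n) {V : Type*} [AddCommGroup V] [Module ℂ V]
    [LieRingModule (Sp n) V] [LieModule ℂ (Sp n) V] (hV : IsFundamental n k V) :
    Nonempty (kerTheta n k ≃ₗ⁅ℂ, Sp n⁆ V) := by
  obtain ⟨w, hw, hww, -⟩ := exists_highest_kerTheta hkn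
  have hw0 : w ≠ 0 := by
    rintro rfl
    have : formMap (0 : Ext n) 0 = 1 := hww
    simp at this
  obtain ⟨v, hv0, hv1, hv2, hv3⟩ := hV.exists_highest
  have hv4 := hElt_lie_of_coroot hkn hv3
  have hw1 : ∀ i j : Fin n, i < j → ⁅xMinus i j, w⁆ = 0 := fun i j hij =>
    Subtype.ext (xMinus_lie_of_mem_occSpace hw hij)
  have hw2 : ∀ i j : Fin n, ⁅xPlus i j, w⁆ = 0 := fun i j =>
    Subtype.ext (xPlus_lie_of_mem_occSpace hw i j)
  have hw4 : ∀ i : Fin n, ⁅hElt i, w⁆ = (if i.val < k then (1 : ℂ) else 0) • w := fun i =>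
    Subtype.ext (hElt_lie_of_mem_occSpace hw i)
  let S : Set (Sp n) := {x | ∃ m : ℕ, 0 < m ∧ ⁅gradingElt n, x⁆ = (-(m : ℂ)) • x}
  -- The elements acting on both vectors by the same scalar. These include the positive root
  -- vectors, with scalar `0`, the `h_i` and the grading element; the negative root vectors lie in
  -- `S`.
  let T : Set (Sp n) := {x | ∃ c : ℂ, ⁅x, w⁆ = c • w ∧ ⁅x, v⁆ = c • v}
  have hT : ∀ x ∈ T, x ∈ Submodule.span ℂ S ⊔ Submodule.span ℂ T := fun x hx =>
    Submodule.mem_sup_right (Submodule.subset_span hx)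
  have hS : ∀ x ∈ S, x ∈ Submodule.span ℂ S ⊔ Submodule.span ℂ T := fun x hx =>
    Submodule.mem_sup_left (Submodule.subset_span hx)
  refine nonempty_equiv_of_highestWeight (S := S) (T := T) (h := gradingElt n)
    (kerTheta_isIrreducible hkn) hV.irreducible ?_ (fun x hx => hx) ?_ hw0 hv0 (fun b hb => hb)
  · rw [eq_top_iff]
    rintro X -
    rw [sp_eq_sum X]
    refine Submodule.sum_mem _ fun i _ => Submodule.sum_mem _ fun j _ =>
      Submodule.add_mem _ (Submodule.add_mem _ (Submodule.smul_mem _ _ ?_)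
        (Submodule.smul_mem _ _ ?_)) (Submodule.smul_mem _ _ ?_)
    · rcases lt_trichotomy i j with hij | rfl | hij
      · exact hT _ ⟨0, by rw [hw1 i j hij, zero_smul], by rw [hv1 i j hij, zero_smul]⟩
      · exact hT _ ⟨_, hw4 i, hv4 i⟩
      · refine hS _ ⟨i - j, Nat.sub_pos_of_lt hij, ?_⟩
        rw [gradingElt_lie_xMinus, Nat.cast_sub (le_of_lt hij), neg_sub]
    · exact hT _ ⟨0, by rw [hw2, zero_smul], by rw [hv2, zero_smul]⟩
    · exact hS _ ⟨_, by omega, gradingElt_lie_xLow i j⟩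
  · refine ⟨∑ i : Fin n, gradingWeight i * if i.val < k then (1 : ℂ) else 0, ?_, ?_⟩
    · rw [gradingElt, sum_lie, Finset.sum_smul]
      exact Finset.sum_congr rfl fun i _ => by rw [smul_lie, hw4, smul_smul]
    · rw [gradingElt, sum_lie, Finset.sum_smul]
      exact Finset.sum_congr rfl fun i _ => by rw [smul_lie, hv4, smul_smul]

lemma ι_mem_kerTheta_one (v : Idx n → ℂ) : ExteriorAlgebra.ι ℂ v ∈ kerTheta n 1 := by
  refine ⟨?_, ?_⟩
  · rw [ExteriorAlgebra.exteriorPower, pow_one]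
    exact ⟨v, rfl⟩
  · change theta n (ExteriorAlgebra.ι ℂ v) = 0
    have := theta_ι_mul v 1
    rw [mul_one, theta_one, mul_zero, add_zero, contract, CliffordAlgebra.contractLeft_one] at this
    exact this

/-- The natural module is `Ker θ_1`. -/
lemma nonempty_natural_equiv : Nonempty ((Idx n → ℂ) ≃ₗ⁅ℂ, Sp n⁆ kerTheta n 1) := by
  let f : (Idx n → ℂ) →ₗ⁅ℂ, Sp n⁆ kerTheta n 1 :=
    { toFun := fun v => ⟨ExteriorAlgebra.ι ℂ v, ι_mem_kerTheta_one v⟩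
      map_add' := fun v w => Subtype.ext (map_add _ v w)
      map_smul' := fun c v => Subtype.ext (map_smul _ c v)
      map_lie' := fun {A v} => Subtype.ext (by
        have := lie_ι_mul (A : Matrix (Idx n) (Idx n) ℂ) v 1
        rw [lie_one, mul_zero, add_zero, mul_one, mul_one] at this
        exact this.symm) }
  have hf : Function.Bijective f := by
    refine ⟨fun v w h => ExteriorAlgebra.ι_leftInverse.injective (congrArg Subtype.val h), fun x => ?_⟩
    have := x.2.1
    rw [ExteriorAlgebra.exteriorPower, pow_one] at this
    obtain ⟨v, hv⟩ := this
    exact ⟨v, Subtype.ext hv⟩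
  exact ⟨{ f, LinearEquiv.ofBijective (f : (Idx n → ℂ) →ₗ[ℂ] kerTheta n 1) hf with }⟩

end Fundamental

/-! ### Submodules of the Shen-Larsson modules -/

section Submodules

variable {n : ℕ} {V : Type*} [AddCommGroup V] [Module ℂ V] [LieRingModule (Sp n) V]
  [LieModule ℂ (Sp n) V] (α β : Idx n → ℂ)

/-- The span of a set that is stable under the `H_r` and the `d_i` modulo linear combinations. -/
def spanSubmodule (G : Set (ShenLarsson α β V))
    (hH : ∀ g ∈ G, ∀ r : Idx n → ℤ, ⁅Ham.H r, g⁆ ∈ Submodule.span ℂ G)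
    (hd : ∀ g ∈ G, ∀ i : Idx n, ⁅(Ham.d i : Ham n), g⁆ ∈ Submodule.span ℂ G) :
    LieSubmodule ℂ (Ham n) (ShenLarsson α β V) where
  toSubmodule := Submodule.span ℂ G
  lie_mem := by
    intro x w hw
    change w ∈ Submodule.span ℂ G at hw
    change ⁅x, w⁆ ∈ Submodule.span ℂ G
    induction hw using Submodule.span_induction with
    | mem g hg =>
      induction (Ham.basis n).mem_span x using Submodule.span_induction with
      | mem x hx =>
        obtain ⟨r | i, rfl⟩ := hx
        · rw [Ham.basis_inl]; exact hH g hg _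
        · rw [Ham.basis_inr]; exact hd g hg _
      | zero => rw [zero_lie]; exact Submodule.zero_mem _
      | add x y _ _ hx hy => rw [add_lie]; exact Submodule.add_mem _ hx hy
      | smul c x _ hx => rw [smul_lie]; exact Submodule.smul_mem _ _ hx
    | zero => rw [lie_zero]; exact Submodule.zero_mem _
    | add w w' _ _ h h' => rw [lie_add]; exact Submodule.add_mem _ h h'
    | smul c w _ h => rw [lie_smul]; exact Submodule.smul_mem _ _ h

/-- Homogeneous elements `e v ⊗ t^s`, `v ∈ G s`, span a submodule if the `G s` are stable. -/
lemma exists_submodule_of_stable {W : Type*} [AddCommGroup W] [Module ℂ W] [LieRingModule (Sp n) W]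
    [LieModule ℂ (Sp n) W] (e : W ≃ₗ⁅ℂ, Sp n⁆ V) (G : (Idx n → ℤ) → Set W)
    (hG : ∀ s, ∀ w ∈ G s, ∀ r : Idx n → ℤ,
      (bar (toC r) ⬝ᵥ (toC s + α)) • w + ⁅rankOne (toC r), w⁆ ∈ Submodule.span ℂ (G (r + s)))
    {U : Type*} [AddCommGroup U] [Module ℂ U] (s : Idx n → ℤ) (f : W →ₗ[ℂ] U)
    (hf : ∀ w ∈ G s, f w = 0) (w₀ : W) (hw₀ : f w₀ ≠ 0) (w₁ : W) (hw₁ : w₁ ∈ G s) (hw₁' : w₁ ≠ 0) :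
    ∃ P : LieSubmodule ℂ (Ham n) (ShenLarsson α β V), P ≠ ⊥ ∧ P ≠ ⊤ ∧
      P.toSubmodule = Submodule.span ℂ {x | ∃ r, ∃ w ∈ G r, x = ShenLarsson.tmul α β (e w) r} := by
  set X : Set (ShenLarsson α β V) := {x | ∃ r, ∃ w ∈ G r, x = ShenLarsson.tmul α β (e w) r} with hX
  have hmem : ∀ r, ∀ w ∈ Submodule.span ℂ (G r),
      ShenLarsson.tmul α β (e w) r ∈ Submodule.span ℂ X := by
    intro r w hw
    induction hw using Submodule.span_induction with
    | mem w hw => exact Submodule.subset_span ⟨r, w, hw, rfl⟩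
    | zero =>
      rw [map_zero]
      convert Submodule.zero_mem _
      exact TensorProduct.zero_tmul _ _
    | add w w' _ _ h h' =>
      rw [map_add]
      convert Submodule.add_mem _ h h' using 1
      exact TensorProduct.add_tmul _ _ _
    | smul c w _ h =>
      rw [map_smul]
      exact Submodule.smul_mem _ c h
  let P := spanSubmodule α β X (by
      rintro _ ⟨s, w, hw, rfl⟩ r
      rw [ShenLarsson.H_lie, ← LieModuleEquiv.coe_toLieModuleHom, ← LieModuleHom.map_lie,
        ← map_smul, ← map_add]
      exact hmem _ _ (hG s w hw r)) (by
      rintro _ ⟨s, w, hw, rfl⟩ i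
      rw [ShenLarsson.d_lie]
      exact Submodule.smul_mem _ _ (Submodule.subset_span ⟨s, w, hw, rfl⟩))
  have hP : P.toSubmodule = Submodule.span ℂ X := rfl
  -- the coefficient of `t^s`
  let coef : ShenLarsson α β V →ₗ[ℂ] W :=
    (TensorProduct.lift (LinearMap.flip
      ((monoBasis n).constr ℂ fun m => if m = s then (e.symm : V →ₗ[ℂ] W) else 0)) :
        V ⊗[ℂ] Laurent n →ₗ[ℂ] W)
  have hcoef : ∀ w r, coef (ShenLarsson.tmul α β (e w) r) = if r = s then w else 0 := by
    intro w r
    change TensorProduct.lift _ (e w ⊗ₜ mono r) = _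
    rw [TensorProduct.lift.tmul, LinearMap.flip_apply, ← monoBasis_apply, Module.Basis.constr_basis]
    split_ifs
    · exact e.symm_apply_apply w
    · rfl
  refine ⟨P, ?_, ?_, hP⟩
  · intro h
    have h1 : ShenLarsson.tmul α β (e w₁) s ∈ P := Submodule.subset_span ⟨s, w₁, hw₁, rfl⟩
    rw [h, LieSubmodule.mem_bot] at h1
    have h2 := hcoef w₁ s
    rw [h1, map_zero, if_pos rfl] at h2
    exact hw₁' h2.symm
  · intro h
    have h1 : ShenLarsson.tmul α β (e w₀) s ∈ P.toSubmodule := h ▸ LieSubmodule.mem_top _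
    rw [hP] at h1
    -- The map `f` is the test for properness: composed with the coefficient of `t^s` it kills every
    -- generator, but not `e w₀ ⊗ t^s`.
    have h2 : Submodule.span ℂ X ≤ LinearMap.ker (f ∘ₗ coef) := by
      rw [Submodule.span_le]
      rintro _ ⟨r, w, hw, rfl⟩
      change f (coef _) = 0
      rw [hcoef]
      split_ifs with hr
      · exact hf w (hr ▸ hw)
      · exact map_zero f
    have h3 : f (coef _) = 0 := h2 h1
    rw [hcoef, if_pos rfl] at h3
    exact hw₀ h3

/-- A degree whose translate by `α` has a nonzero coordinate at `i`. -/
lemma exists_toC_add_ne_zero (i : Idx n) : ∃ r : Idx n → ℤ, (toC r + α) i ≠ 0 := by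
  by_cases h : α i = 0
  · exact ⟨1, by simp [toC, h]⟩
  · exact ⟨0, by simpa using h⟩

lemma rankOne_lie_vec (r v : Idx n → ℂ) : ⁅rankOne r, v⁆ = (bar r ⬝ᵥ v) • r := by
  change Matrix.vecMulVec r (bar r) *ᵥ v = _
  rw [Matrix.vecMulVec_mulVec, op_smul_eq_smul]

/-- The submodule of `F^{α,β}` of the natural module. -/
theorem exists_submodule_natural (hn : 1 ≤ n) (e : (Idx n → ℂ) ≃ₗ⁅ℂ, Sp n⁆ V) :
    ∃ P : LieSubmodule ℂ (Ham n) (ShenLarsson α β V), P ≠ ⊥ ∧ P ≠ ⊤ ∧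
      P.toSubmodule = Submodule.span ℂ
        {x | ∃ r : Idx n → ℤ, x = ShenLarsson.tmul α β (e (toC r + α)) r} := by
  obtain ⟨s, hs⟩ := exists_toC_add_ne_zero α (Sum.inr (⟨0, hn⟩ : Fin n))
  -- With `u = s + α`, the functional `(ū, _)` kills `u` since the symplectic form is alternating,
  -- and takes the value `u_{n+1} ≠ 0` on `e_1`.
  have := exists_submodule_of_stable α β e (fun r => {toC r + α}) (fun s w hw r => ?_) s
    (dotFun (bar (toC s + α))) ?_ (Pi.single (Sum.inl ⟨0, hn⟩) 1) ?_ (toC s + α) rfl ?_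
  · simpa using this
  · rw [Set.mem_singleton_iff] at hw
    rw [hw, rankOne_lie_vec, ← smul_add, toC_add]
    exact Submodule.smul_mem _ _ (Submodule.subset_span
      (by rw [Set.mem_singleton_iff]; abel))
  · rintro w rfl
    rw [dotFun_apply, bar_dotProduct_self]
  · rw [dotFun_apply, dotProduct_single, mul_one]
    exact hs
  · intro h; rw [h] at hs; exact hs rfl

/-- The factorization behind both stability statements: the image of `r r̄ᵗ` lies in the multiples
of `r`, which `r ∧ _` annihilates. -/
lemma rankOne_lie_ext (r : Idx n → ℂ) (x : Ext n) :
    ⁅rankOne r, x⁆ = ExteriorAlgebra.ι ℂ r * contract (dotFun (bar r)) x := by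
  rw [sp_lie_ext]
  change extAct (Matrix.vecMulVec r (bar r)) x = _
  rw [extAct_eq_sum, ι_mul_eq_sum]
  refine Finset.sum_congr rfl fun i _ => ?_
  simp [dotFun, Matrix.vecMulVec_apply, LinearMap.sum_apply, Finset.smul_sum, smul_smul,
    annihilation]

/-- Stability of `(s + α) ∧ ⋀^{k-1}` under the operators defining the action of `H_r`. -/
lemma smul_add_lie_mem_wedgeWith {k : ℕ} (r u : Idx n → ℂ) {w : Ext n}
    (hw : w ∈ wedgeWith k u) :
    (bar r ⬝ᵥ u) • w + ⁅rankOne r, w⁆ ∈ wedgeWith k (r + u) := by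
  obtain ⟨y, hy, rfl⟩ := hw
  refine ⟨(bar r ⬝ᵥ u) • y + ⁅rankOne r, y⁆, Submodule.add_mem _ (Submodule.smul_mem _ _ hy)
    (lie_mem_exteriorPower _ _ hy), ?_⟩
  simp only [LinearMap.mulLeft_apply]
  have h1 : ⁅rankOne r, ExteriorAlgebra.ι ℂ u * y⁆ =
      ExteriorAlgebra.ι ℂ ⁅rankOne r, u⁆ * y + ExteriorAlgebra.ι ℂ u * ⁅rankOne r, y⁆ :=
    lie_ι_mul _ u y
  have h2 : ExteriorAlgebra.ι ℂ r * ⁅rankOne r, y⁆ = 0 := by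
    rw [rankOne_lie_ext, ← mul_assoc, ExteriorAlgebra.ι_sq_zero, zero_mul]
  rw [h1, rankOne_lie_vec, map_add, add_mul, mul_add, mul_add, h2, map_smul, smul_mul_assoc,
    mul_smul_comm, mul_smul_comm]
  abel

lemma rankOne_lie_mem_wedgeWith {k : ℕ} (hk : 1 ≤ k) (r : Idx n → ℂ) {w : Ext n}
    (hw : w ∈ ⋀[ℂ]^k (Idx n → ℂ)) : ⁅rankOne r, w⁆ ∈ wedgeWith k r := by
  rw [rankOne_lie_ext]
  obtain ⟨k, rfl⟩ := Nat.exists_eq_add_of_le' hk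
  exact ⟨_, contract_mem_exteriorPower _ hw, rfl⟩

/-- The submodule of `F^{α,β}` of `Ker θ_k`. -/
theorem exists_submodule_kerTheta {k : ℕ} (hk : 1 ≤ k) (hkn : k ≤ n)
    (e : kerTheta n k ≃ₗ⁅ℂ, Sp n⁆ V) :
    ∃ P : LieSubmodule ℂ (Ham n) (ShenLarsson α β V), P ≠ ⊥ ∧ P ≠ ⊤ ∧
      P.toSubmodule = Submodule.span ℂ
        {x | ∃ (r : Idx n → ℤ) (w : kerTheta n k),
          ((w : Ext n) ∈ wedgeWith k (toC r + α) ∨ toC r + α = 0) ∧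
          x = ShenLarsson.tmul α β (e w) r} := by
  obtain ⟨w, hw, hww, -⟩ := exists_highest_kerTheta hkn
  have hw0 : (w : Ext n) ≠ 0 := by
    intro h
    have : formMap (w : Ext n) w = 1 := hww
    rw [h] at this
    simp at this
  set i : Fin n := ⟨0, hk.trans hkn⟩
  -- The vector `w` does not involve `e_{n+1}`, whereas `u` does, so `u ∧ _` can be undone by
  -- contracting with the coordinate `n + 1`.
  obtain ⟨s, hs⟩ := exists_toC_add_ne_zero α (Sum.inr i)
  set u := toC s + α with hu
  have hcontract : ∀ x : Ext n, annihilation (Sum.inr i) x = 0 →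
      annihilation (Sum.inr i) (ExteriorAlgebra.ι ℂ u * x) = u (Sum.inr i) • x := fun x hx => by
    have := contract_ι_mul (coordFun (Sum.inr i)) u x
    change _ = _ - _ * annihilation (Sum.inr i) x at this
    rw [hx, mul_zero, sub_zero] at this
    exact this
  have hwi : annihilation (Sum.inr i) (w : Ext n) = 0 :=
    annihilation_eq_zero_of_notMem hw (inr_notMem_firstIdx i)
  have hne : ExteriorAlgebra.ι ℂ u * (w : Ext n) ≠ 0 := fun h => by
    have := hcontract w hwi
    rw [h, map_zero] at this
    exact smul_ne_zero hs hw0 this.symm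
  -- If `u ∧ ι_ū w` vanished, so would `ι_ū w`; contracting `e_1 ∧ w = 0` with `ū` would then give
  -- `u_{n+1} w = 0`.
  have hne' : ⁅rankOne u, (w : Ext n)⁆ ≠ 0 := fun h => by
    rw [rankOne_lie_ext] at h
    have h1 := hcontract (contract (dotFun (bar u)) w) (by
      rw [annihilation, CliffordAlgebra.contractLeft_comm]
      change -contract _ (annihilation (Sum.inr i) (w : Ext n)) = 0
      rw [hwi, map_zero, neg_zero])
    rw [h, map_zero] at h1
    have h2 := (smul_eq_zero.1 h1.symm).resolve_left hs
    have h3 := contract_ι_mul (dotFun (bar u)) (Pi.single (Sum.inl i) 1) (w : Ext n)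
    have h4 : ExteriorAlgebra.ι ℂ (Pi.single (Sum.inl i) 1) * (w : Ext n) = 0 :=
      creation_eq_zero_of_mem hw ((inl_mem_firstIdx i).2 hk)
    rw [h2, h4, map_zero, mul_zero, sub_zero, dotFun_apply, dotProduct_single, mul_one] at h3
    exact smul_ne_zero (r := bar u (Sum.inl i)) hs hw0 h3.symm
  -- Properness is tested by `u ∧ _`, which kills `u ∧ ⋀^{k-1}` but not `w`; the nonzero element is
  -- `u ūᵗ w`.
  have := exists_submodule_of_stable α β e
    (fun r => {w | (w : Ext n) ∈ wedgeWith k (toC r + α) ∨ toC r + α = 0}) (fun s w hw r => ?_) s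
    (LinearMap.mulLeft ℂ (ExteriorAlgebra.ι ℂ u) ∘ₗ (kerTheta n k).toSubmodule.subtype) ?_ w hne
    ⁅rankOne u, w⁆ (Or.inl (rankOne_lie_mem_wedgeWith hk u w.2.1))
    (fun h => hne' (congrArg Subtype.val h))
  · simpa using this
  · refine Submodule.subset_span (Or.inl ?_)
    change (bar (toC r) ⬝ᵥ (toC s + α)) • (w : Ext n) + ⁅rankOne (toC r), (w : Ext n)⁆ ∈ _
    rw [toC_add, add_assoc]
    rcases hw with hw | hw
    · exact smul_add_lie_mem_wedgeWith _ _ hw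
    · rw [hw, dotProduct_zero, zero_smul, zero_add, add_zero]
      exact rankOne_lie_mem_wedgeWith hk _ w.2.1
  · rintro x (hx | hx)
    · obtain ⟨y, -, hy⟩ := hx
      change ExteriorAlgebra.ι ℂ u * (x : Ext n) = 0
      rw [← hy, LinearMap.mulLeft_apply, ← mul_assoc, ExteriorAlgebra.ι_sq_zero, zero_mul]
    · rw [← hu] at hx
      rw [hx] at hs
      exact absurd rfl hs

end Submodules

end Hamiltonian

end

open Hamiltonian
theorem theorem2 (n k : ℕ) (hk : 1 ≤ k) (hkn : k ≤ n) (α β : Idx n → ℂ)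
    (V : Type*) [AddCommGroup V] [Module ℂ V] [LieRingModule (Sp n) V] [LieModule ℂ (Sp n) V]
    (hV : IsFundamental n k V) :
    IsReducible n (ShenLarsson α β V) ∧
    (k = 1 →
      Nonempty ((Idx n → ℂ) ≃ₗ⁅ℂ, Sp n⁆ V) ∧
      ∀ e : (Idx n → ℂ) ≃ₗ⁅ℂ, Sp n⁆ V,
        ∃ P : LieSubmodule ℂ (Ham n) (ShenLarsson α β V), P ≠ ⊥ ∧ P ≠ ⊤ ∧
          P.toSubmodule = Submodule.span ℂ
            {x | ∃ r : Idx n → ℤ, x = ShenLarsson.tmul α β (e (toC r + α)) r}) ∧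
    (2 ≤ k →
      Nonempty (kerTheta n k ≃ₗ⁅ℂ, Sp n⁆ V) ∧
      ∀ e : kerTheta n k ≃ₗ⁅ℂ, Sp n⁆ V,
        ∃ P : LieSubmodule ℂ (Ham n) (ShenLarsson α β V), P ≠ ⊥ ∧ P ≠ ⊤ ∧
          P.toSubmodule = Submodule.span ℂ
            {x | ∃ (r : Idx n → ℤ) (w : kerTheta n k),
              ((w : Ext n) ∈ wedgeWith k (toC r + α) ∨ toC r + α = 0) ∧
              x = ShenLarsson.tmul α β (e w) r}) := by
  have hK := nonempty_kerTheta_equiv hkn hV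
  refine ⟨?_, ?_, fun _ => ⟨hK, fun e => exists_submodule_kerTheta α β hk hkn e⟩⟩
  -- The submodule built from `Ker θ_k` exists for `k = 1` as well, so reducibility needs no case
  -- distinction.
  · obtain ⟨e⟩ := hK
    obtain ⟨P, h1, h2, -⟩ := exists_submodule_kerTheta α β hk hkn e
    exact ⟨P, h1, h2⟩
  · rintro rfl
    obtain ⟨e⟩ := hK
    obtain ⟨f⟩ := nonempty_natural_equiv (n := n)
    exact ⟨⟨f.trans e⟩, fun e => exists_submodule_natural α β hkn e⟩
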